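/- Theorem (Marton inner bound). Let $x \mapsto \rho_x^{B_1B_2}$, $x \in \mathcal{X}$, be a classical-quantum broadcast channel: each $\rho_x^{B_1B_2}$ is a density operator on $\mathcal{H}^{B_1} \otimes \mathcal{H}^{B_2}$, where $\mathcal{H}^{B_1}$ and $\mathcal{H}^{B_2}$ are finite-dimensional. Let $p$ be a probability distribution on $\mathcal{U}_1 \times \mathcal{U}_2$, where $\mathcal{U}_1, \mathcal{U}_2$ are finite sets, let $f : \mathcal{U}_1 \times \mathcal{U}_2 \to \mathcal{X}$ be a function, and put $$\theta^{U_1U_2B_1B_2} = \sum_{u_1,u_2} p(u_1,u_2)\, |u_1\rangle\langle u_1|^{U_1} \otimes |u_2\rangle\langle u_2|^{U_2} \otimes \rho^{B_1B_2}_{f(u_1,u_2)} .$$ Then every pair of real numbers $R_1, R_2 \ge 0$ with $$R_1 \le I(U_1;B_1)_\theta, \qquad R_2 \le I(U_2;B_2)_\theta, \qquad R_1 + R_2 \le I(U_1;B_1)_\theta + I(U_2;B_2)_\theta - I(U_1;U_2)_\theta$$ is achievable with no common message, i.e. the rate triple $(R_1, 0, R_2)$ is achievable. Here $I(A;B)_\rho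 = H(A)_\rho + H(B)_\rho - H(AB)_\rho$ is evaluated on the reduced states, with the von Neumann entropy $H(\rho) = -\mathrm{Tr}(\rho \log_2 \rho)$. For $x^n \in \mathcal{X}^n$ put $\rho_{x^n}^{B_1^nB_2^n} = \rho_{x_1}^{B_1B_2} \otimes \cdots \otimes \rho_{x_n}^{B_1B_2}$. An $(n, R_1, R, R_2, \epsilon)$ code consists of message sets $\mathcal{M}_1, \mathcal{M}, \mathcal{M}_2$ of sizes $\max(1, \lfloor 2^{nR_1} \rfloor)$, $\max(1, \lfloor 2^{nR} \rfloor)$, $\max(1, \lfloor 2^{nR_2} \rfloor)$, codewords $x^n(m_1,m,m_2) \in \mathcal{X}^n$, a POVM $\{\Lambda_{m_1,m}\}$ on $B_1^n$ and a POVM $\{\Gamma_{m,m_2}\}$ on $B_2^n$, such that $$\frac{1}{|\mathcal{M}_1||\mathcal{M}||\mathcal{M}_2|} \sum_{m_1,m,m_2} \mathrm{Tr}\left[ \left( I - \Lambda_{m_1,m} \otimes \Gamma_{m,m_2} \right) \rho^{B_1^nB_2^n}_{x^n(m_1,m,m_2)} \right] \le \epsilon .$$ The triple $(R_1, R, R_2)$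 is achievable if for all $\epsilon, \delta > 0$ and all sufficiently large $n$ there is an $(n, R_1 - \delta, R - \delta, R_2 - \delta, \epsilon)$ code. -/

import Mathlib

open scoped Kronecker ComplexOrder

noncomputable section

namespace CQBroadcast

/-- A density matrix: positive semidefinite with unit trace. -/
structure IsDensityMatrix {d : Type*} [Fintype d] (ρ : Matrix d d ℂ) : Prop where
  posSemidef : ρ.PosSemidef
  trace_eq_one : ρ.trace = 1

/-- A positive operator-valued measure with finitely many outcomes `m`. -/
structure IsPOVM {M d : Type*} [Fintype M] [Fintype d] [DecidableEq d]
    (Λ : M → Matrix d d ℂ) : Prop where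
  posSemidef : ∀ m, (Λ m).PosSemidef
  sum_eq_one : ∑ m, Λ m = 1

/-- The von Neumann entropy `H(ρ) = -Tr(ρ log₂ ρ)` in bits. The logarithm is taken by the
functional calculus of Hermitian matrices, with `0 log₂ 0 = 0`. -/
def vonNeumannEntropy {d : Type*} [Fintype d] [DecidableEq d] (ρ : Matrix d d ℂ) : ℝ :=
  -((ρ * cfc (Real.logb 2) ρ).trace).re

/-- The partial trace `ρ^A = Tr_B ρ^{AB}`. -/
def traceRight {A B : Type*} [Fintype B] (ρ : Matrix (A × B) (A × B) ℂ) : Matrix A A ℂ :=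
  Matrix.of fun a a' => ∑ b, ρ (a, b) (a', b)

/-- The partial trace `ρ^B = Tr_A ρ^{AB}`. -/
def traceLeft {A B : Type*} [Fintype A] (ρ : Matrix (A × B) (A × B) ℂ) : Matrix B B ℂ :=
  Matrix.of fun b b' => ∑ a, ρ (a, b) (a, b')

/-- The quantum mutual information `I(A;B)_ρ = H(A)_ρ + H(B)_ρ - H(AB)_ρ` of a state `ρ^{AB}`. -/
def mutualInfo {A B : Type*} [Fintype A] [DecidableEq A] [Fintype B] [DecidableEq B]
    (ρ : Matrix (A × B) (A × B) ℂ) : ℝ :=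
  vonNeumannEntropy (traceRight ρ) + vonNeumannEntropy (traceLeft ρ) - vonNeumannEntropy ρ

/-- A classical-quantum broadcast channel `x ↦ ρ_x^{B₁B₂}`. The output spaces are `ℂ^B₁` and
`ℂ^B₂`, and their tensor product is `ℂ^(B₁ × B₂)`. -/
structure Channel (X B₁ B₂ : Type*) [Fintype B₁] [Fintype B₂] where
  state : X → Matrix (B₁ × B₂) (B₁ × B₂) ℂ
  isDensityMatrix : ∀ x, IsDensityMatrix (state x)

section BroadcastCodes

variable {X B₁ B₂ : Type*} [Fintype B₁] [Fintype B₂]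

/-- The output `ρ_{x₁} ⊗ ⋯ ⊗ ρ_{xₙ}` of `n` channel uses on the input `xⁿ`. The tensor factors are
grouped by receiver: Receiver 1 holds `B₁ⁿ`, with basis `Fin n → B₁`, and Receiver 2 holds `B₂ⁿ`,
with basis `Fin n → B₂`. -/
def Channel.output (N : Channel X B₁ B₂) {n : ℕ} (x : Fin n → X) :
    Matrix ((Fin n → B₁) × (Fin n → B₂)) ((Fin n → B₁) × (Fin n → B₂)) ℂ :=
  Matrix.of fun b b' => ∏ i, N.state (x i) (b.1 i, b.2 i) (b'.1 i, b'.2 i)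

/-- The size `|𝓜|` of the message set of an `n`-symbol code of rate `R` (in bits): `⌊2^{nR}⌋`, and
at least `1`. At a rate `R ≤ 0` there is a single message, so nothing to transmit. -/
def messageCount (n : ℕ) (R : ℝ) : ℕ :=
  max 1 ⌊(2 : ℝ) ^ ((n : ℝ) * R)⌋₊

variable [DecidableEq B₁] [DecidableEq B₂]

/-- A code with `n` channel uses, personal messages of rates `R₁` and `R₂`, a common message
of rate `R`, and average probability of error at most `ε`. (The traces in the error probability are
real; `re` is only the passage from `ℂ` to `ℝ`.) -/
structure Code (N : Channel X B₁ B₂) (n : ℕ) (R₁ R R₂ ε : ℝ) where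
  /-- the codebook `xⁿ(m₁, m, m₂)` -/
  codeword : Fin (messageCount n R₁) → Fin (messageCount n R) → Fin (messageCount n R₂) →
    (Fin n → X)
  /-- the measurement of Receiver 1 -/
  Λ : Fin (messageCount n R₁) × Fin (messageCount n R) →
    Matrix (Fin n → B₁) (Fin n → B₁) ℂ
  /-- the measurement of Receiver 2 -/
  Γ : Fin (messageCount n R) × Fin (messageCount n R₂) →
    Matrix (Fin n → B₂) (Fin n → B₂) ℂ
  isPOVM_Λ : IsPOVM Λ
  isPOVM_Γ : IsPOVM Γ
  /-- the average over all messages of `Tr[(I - Λ_{m₁,m} ⊗ Γ_{m,m₂}) ρ_{xⁿ(m₁,m,m₂)}]` -/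
  error_le :
    1 / ((messageCount n R₁ : ℝ) * (messageCount n R : ℝ) * (messageCount n R₂ : ℝ)) *
      ∑ m₁, ∑ m, ∑ m₂,
        (((1 - Λ (m₁, m) ⊗ₖ Γ (m, m₂)) * N.output (codeword m₁ m m₂)).trace).re ≤ ε

/-- The rate triple `(R₁, R, R₂)` is achievable: for all `ε, δ > 0` and all sufficiently large `n`
there is an `(n, R₁ - δ, R - δ, R₂ - δ, ε)` code. -/
def Channel.Achievable (N : Channel X B₁ B₂) (R₁ R R₂ : ℝ) : Prop :=
  ∀ ε > 0, ∀ δ > 0, ∃ n₀ : ℕ, ∀ n ≥ n₀, Nonempty (Code N n (R₁ - δ) (R - δ) (R₂ - δ) ε)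

/-- The code state on `U₁U₂B₁B₂`,
`θ = ∑ p(u₁,u₂) |u₁⟩⟨u₁| ⊗ |u₂⟩⟨u₂| ⊗ ρ_{f(u₁,u₂)}^{B₁B₂}`. -/
def Channel.codeState {U₁ U₂ : Type*} [Fintype U₁] [DecidableEq U₁] [Fintype U₂] [DecidableEq U₂]
    (N : Channel X B₁ B₂) (p : U₁ × U₂ → ℝ) (f : U₁ → U₂ → X) :
    Matrix (U₁ × U₂ × B₁ × B₂) (U₁ × U₂ × B₁ × B₂) ℂ :=
  ∑ u₁, ∑ u₂, (p (u₁, u₂) : ℂ) •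
    (Matrix.single u₁ u₁ (1 : ℂ) ⊗ₖ (Matrix.single u₂ u₂ (1 : ℂ) ⊗ₖ N.state (f u₁ u₂)))

/-- The reduced state `θ^{U₁B₁}` of `θ^{U₁U₂B₁B₂}`. -/
def reduceU₁B₁ {U₁ U₂ B₁ B₂ : Type*} [Fintype U₂] [Fintype B₂]
    (θ : Matrix (U₁ × U₂ × B₁ × B₂) (U₁ × U₂ × B₁ × B₂) ℂ) : Matrix (U₁ × B₁) (U₁ × B₁) ℂ :=
  Matrix.of fun a a' => ∑ u₂, ∑ b₂, θ (a.1, u₂, a.2, b₂) (a'.1, u₂, a'.2, b₂)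

/-- The reduced state `θ^{U₂B₂}` of `θ^{U₁U₂B₁B₂}`. -/
def reduceU₂B₂ {U₁ U₂ B₁ B₂ : Type*} [Fintype U₁] [Fintype B₁]
    (θ : Matrix (U₁ × U₂ × B₁ × B₂) (U₁ × U₂ × B₁ × B₂) ℂ) : Matrix (U₂ × B₂) (U₂ × B₂) ℂ :=
  Matrix.of fun a a' => ∑ u₁, ∑ b₁, θ (u₁, a.1, b₁, a.2) (u₁, a'.1, b₁, a'.2)

/-- The reduced state `θ^{U₁U₂}` of `θ^{U₁U₂B₁B₂}`. -/
def reduceU₁U₂ {U₁ U₂ B₁ B₂ : Type*} [Fintype B₁] [Fintype B₂]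
    (θ : Matrix (U₁ × U₂ × B₁ × B₂) (U₁ × U₂ × B₁ × B₂) ℂ) : Matrix (U₁ × U₂) (U₁ × U₂) ℂ :=
  Matrix.of fun a a' => ∑ b₁, ∑ b₂, θ (a.1, a.2, b₁, b₂) (a'.1, a'.2, b₁, b₂)

end BroadcastCodes

end CQBroadcast

end

/-! The proof is random coding with binning. Two independent codebooks are drawn, `c₁` with i.i.d.
`p₁`-letters and `c₂` with i.i.d. `p₂`-letters; message `mᵢ` owns a bin of about `2 ^ (n * rᵢ)`
words. For a message pair the sender picks one word from each bin and transmits `f` of them letter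
by letter. Receiver `i` decodes its own codebook with a square-root measurement.

Decoding. If a codebook has total rate below `I(Uᵢ;Bᵢ)`, the expected error for the marginal channel
from `Uᵢ` to `Bᵢ` tends to zero. The Hayashi–Nagaoka inequality (`hayashi_nagaoka`) bounds the error
by a missed detection plus false alarms on independent words. Typical spectral projections
(`exists_typical_tests`) make the first term small and each false alarm about `2 ^ (-n I(Uᵢ;Bᵢ))`.

Covering. The words were drawn independently, whereas the marginal channels presuppose pairs
distributed as `p ^ n`. The likelihood ratio `w` of `p ^ n` to `p₁ ^ n × p₂ ^ n`, truncated at `K ≈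
2 ^ (n I(U₁;U₂))`, corrects this. By a second-moment bound (`sum_sq_covering_le`) the average of `w`
over a pair of bins is close to 1 as soon as `r₁ + r₂ > I(U₁;U₂)`. The sender takes the pair of
least error, which is no worse than the `w`-weighted average. In expectation that average is bounded
by the two marginal errors, because each decoder depends on its own codebook only and `w` turns the
independent partner word into a conditionally distributed one (`sum_weighted_error_le`). Hence the
dependence of the chosen pair on the codebooks never has to be analysed.

Rates. At message rate `Rᵢ - δ`, the choice `rᵢ = Iᵢ - Rᵢ + δ/2` gives total rate `Iᵢ - δ/2`, and
the sum-rate hypothesis says exactly that `r₁ + r₂ ≥ I(U₁;U₂) + δ`. A receiver with a single message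
decodes nothing, so its bin may be as large as needed. -/

open scoped Kronecker ComplexOrder

noncomputable section

namespace CQBroadcast

/-! ### Moments of independent letters and the weak law of large numbers. -/

section IIDSums

variable {ι V : Type*} [Fintype ι]

/-- The weight `∏ i, q (c i)` of the word `c` under independent letters with weights `q`. -/
def prodWeight (q : V → ℝ) (c : ι → V) : ℝ := ∏ i, q (c i)

lemma prodWeight_nonneg {q : V → ℝ} (hq : ∀ v, 0 ≤ q v) (c : ι → V) : 0 ≤ prodWeight q c :=
  Finset.prod_nonneg fun _ _ => hq _

variable [DecidableEq ι] [Fintype V]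

lemma sum_prodWeight (q : V → ℝ) (hq : ∑ v, q v = 1) : ∑ c : ι → V, prodWeight q c = 1 := by
  simp only [prodWeight]
  rw [← Fintype.prod_sum (fun (_ : ι) v => q v)]
  simp [hq]

/-- Independence as a factorization: the one- and two-letter moments below are obtained by taking
all but one or two of the `g i` equal to 1. -/
lemma sum_prodWeight_mul_prod (q : V → ℝ) (g : ι → V → ℝ) :
    ∑ c : ι → V, prodWeight q c * ∏ i, g i (c i) = ∏ i, ∑ v, q v * g i v := by
  simp only [prodWeight, ← Finset.prod_mul_distrib]
  rw [← Fintype.prod_sum (fun i v => q v * g i v)]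

lemma sum_prodWeight_mul_apply {q : V → ℝ} (hq : ∑ v, q v = 1) (i : ι) (F : V → ℝ) :
    ∑ c : ι → V, prodWeight q c * F (c i) = ∑ v, q v * F v := by
  have h := sum_prodWeight_mul_prod q (fun j v => if j = i then F v else 1)
  simp only [Finset.prod_ite_eq', Finset.mem_univ, if_true] at h
  rw [h, Finset.prod_eq_single i]
  · simp
  · intro j _ hj
    simp [hj, hq]
  · simp

lemma sum_prodWeight_mul_apply_mul_apply {q : V → ℝ} (hq : ∑ v, q v = 1) {i j : ι} (hij : i ≠ j)
    (F G : V → ℝ) :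
    ∑ c : ι → V, prodWeight q c * (F (c i) * G (c j)) = (∑ v, q v * F v) * ∑ v, q v * G v := by
  have h := sum_prodWeight_mul_prod q
    (fun k v => (if k = i then F v else 1) * if k = j then G v else 1)
  simp only [Finset.prod_mul_distrib, Finset.prod_ite_eq', Finset.mem_univ, if_true] at h
  rw [h, Finset.prod_eq_mul i j hij]
  · simp [hij, hij.symm]
  · intro k _ hk
    simp [hk.1, hk.2, hq]
  · simp
  · simp

lemma sum_prodWeight_mul_apply_apply {q : V → ℝ} (hq : ∑ v, q v = 1) {i j : ι} (hij : i ≠ j)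
    (F : V → V → ℝ) :
    ∑ c : ι → V, prodWeight q c * F (c i) (c j) = ∑ v, ∑ v', q v * (q v' * F v v') := by
  classical
  have h (c : ι → V) : prodWeight q c * F (c i) (c j) =
      ∑ a, prodWeight q c * ((if c i = a then 1 else 0) * F a (c j)) := by
    simp
  simp only [h]
  rw [Finset.sum_comm]
  refine Finset.sum_congr rfl fun a _ => ?_
  rw [sum_prodWeight_mul_apply_mul_apply hq hij (fun v => if v = a then 1 else 0) (F a)]
  simp [Finset.mul_sum]

/-- The variance of a sum of independent centred variables. -/
lemma sum_prodWeight_mul_sq {q : V → ℝ} (hq : ∑ v, q v = 1) (g : V → ℝ)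
    (hg : ∑ v, q v * g v = 0) :
    ∑ c : ι → V, prodWeight q c * (∑ i, g (c i)) ^ 2 =
      Fintype.card ι * ∑ v, q v * g v ^ 2 := by
  have h (c : ι → V) : prodWeight q c * (∑ i, g (c i)) ^ 2 =
      ∑ i, ∑ j, prodWeight q c * (g (c i) * g (c j)) := by
    rw [sq, Finset.sum_mul_sum, Finset.mul_sum]
    simp only [Finset.mul_sum]
  simp only [h]
  rw [Finset.sum_comm]
  have h' (i : ι) : ∑ c : ι → V, ∑ j, prodWeight q c * (g (c i) * g (c j)) =
      ∑ v, q v * g v ^ 2 := by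
    rw [Finset.sum_comm, Finset.sum_eq_single i]
    · simpa [sq] using sum_prodWeight_mul_apply hq i (fun v => g v * g v)
    · intro j _ hj
      rw [sum_prodWeight_mul_apply_mul_apply hq hj.symm, hg, zero_mul]
    · simp
  simp [h']

/-- The weak law of large numbers, for sets of words on which the empirical mean of `g` deviates,
up to words of weight zero. -/
lemma sum_prodWeight_le_of_deviation {q : V → ℝ} (hq0 : ∀ v, 0 ≤ q v) (hq : ∑ v, q v = 1)
    (g : V → ℝ) {δ : ℝ} (hδ : 0 < δ) (hι : 0 < Fintype.card ι) (E : (ι → V) → Prop)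
    [DecidablePred E]
    (hE : ∀ c, E c → (∀ i, 0 < q (c i)) →
      Fintype.card ι * δ ≤ |∑ i, (g (c i) - ∑ v, q v * g v)|) :
    ∑ c : ι → V, (if E c then prodWeight q c else 0) ≤
      (∑ v, q v * (g v - ∑ v, q v * g v) ^ 2) / δ ^ 2 / Fintype.card ι := by
  set μ := ∑ v, q v * g v with hμ
  have hn : (0 : ℝ) < Fintype.card ι := by exact_mod_cast hι
  have hcent : ∑ v, q v * (g v - μ) = 0 := by
    simp only [mul_sub, Finset.sum_sub_distrib, ← Finset.sum_mul, hq, ← hμ]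
    ring
  have key := sum_prodWeight_mul_sq (ι := ι) hq (fun v => g v - μ) hcent
  -- Chebyshev pointwise: on `E` the squared deviation is at least `(card ι * δ) ^ 2`, unless the
  -- word has weight zero.
  have hle (c : ι → V) : (if E c then prodWeight q c else 0) ≤
      prodWeight q c * (∑ i, (g (c i) - μ)) ^ 2 / (Fintype.card ι * δ) ^ 2 := by
    have h0 := prodWeight_nonneg hq0 c
    split_ifs with hc
    · by_cases hpos : ∀ i, 0 < q (c i)
      · rw [le_div_iff₀ (by positivity)]
        refine mul_le_mul_of_nonneg_left ?_ h0
        rw [← sq_abs (∑ i, (g (c i) - μ))]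
        exact pow_le_pow_left₀ (by positivity) (hE c hc hpos) 2
      · push Not at hpos
        obtain ⟨i, hi⟩ := hpos
        have : prodWeight q c = 0 :=
          Finset.prod_eq_zero (Finset.mem_univ i) (le_antisymm hi (hq0 _))
        simp [this]
    · positivity
  refine (Finset.sum_le_sum fun c _ => hle c).trans_eq ?_
  rw [← Finset.sum_div, key]
  field_simp

end IIDSums

/-! ### Operator inequalities for measurements. -/

section OperatorInequalities

open scoped MatrixOrder Matrix.Norms.L2Operator

variable {d : Type*} [Fintype d]

/-- The real bilinear form `Re Tr(XY)` on matrices. -/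
def traceForm : Matrix d d ℂ →ₗ[ℝ] Matrix d d ℂ →ₗ[ℝ] ℝ :=
  LinearMap.mk₂ ℝ (fun X Y => ((X * Y).trace).re)
    (fun X X' Y => by simp [add_mul, Matrix.trace_add])
    (fun c X Y => by simp [Matrix.trace_smul])
    (fun X Y Y' => by simp [mul_add, Matrix.trace_add])
    (fun c X Y => by simp [Matrix.trace_smul])

lemma traceForm_apply (X Y : Matrix d d ℂ) : traceForm X Y = ((X * Y).trace).re := rfl

lemma traceForm_nonneg {X Y : Matrix d d ℂ} (hX : 0 ≤ X) (hY : 0 ≤ Y) : 0 ≤ traceForm X Y := by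
  classical
  obtain ⟨Z, rfl⟩ := CStarAlgebra.nonneg_iff_eq_star_mul_self.mp hX
  have h : 0 ≤ (Z * Y * star Z).trace :=
    ((Matrix.nonneg_iff_posSemidef.mp hY).mul_mul_conjTranspose_same Z).trace_nonneg
  rw [traceForm_apply, mul_assoc, Matrix.trace_mul_comm]
  exact (Complex.le_def.mp h).1

lemma traceForm_mono_left {X Y ρ : Matrix d d ℂ} (h : X ≤ Y) (hρ : 0 ≤ ρ) :
    traceForm X ρ ≤ traceForm Y ρ := by
  have := traceForm_nonneg (sub_nonneg.mpr h) hρ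
  rwa [map_sub, LinearMap.sub_apply, sub_nonneg] at this

lemma traceForm_mono_right {X ρ σ : Matrix d d ℂ} (h : ρ ≤ σ) (hX : 0 ≤ X) :
    traceForm X ρ ≤ traceForm X σ := by
  have := traceForm_nonneg hX (sub_nonneg.mpr h)
  rwa [map_sub, sub_nonneg] at this

variable [DecidableEq d]

/-- Since `A * A ≤ A ≤ S`, applying the operator monotone square root twice suffices. -/
lemma le_sqrt_of_le {A S : Matrix d d ℂ} (hA : 0 ≤ A) (hA1 : A ≤ 1) (hAS : A ≤ S) :
    A ≤ CFC.sqrt S := by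
  have h1 : A * A ≤ A := by
    have hs : IsSelfAdjoint (CFC.sqrt A) := (CFC.sqrt_nonneg A).isSelfAdjoint
    have h := IsSelfAdjoint.conjugate_le_conjugate hA1 hs
    rw [mul_one, CFC.sqrt_mul_sqrt_self A] at h
    refine le_trans (le_of_eq ?_) h
    have hQ : CFC.sqrt A * CFC.sqrt A = A := CFC.sqrt_mul_sqrt_self A
    generalize CFC.sqrt A = Q at hQ
    rw [← hQ]
    noncomm_ring
  have h2 : CFC.sqrt (A * A) = A := CFC.sqrt_unique rfl hA
  calc A = CFC.sqrt (A * A) := h2.symm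
    _ ≤ CFC.sqrt A := CFC.sqrt_le_sqrt _ _ h1
    _ ≤ CFC.sqrt S := CFC.sqrt_le_sqrt _ _ hAS

/-- The Hayashi–Nagaoka inequality, with a square root `Q` of `A + T` and its inverse `R`. -/
lemma hayashi_nagaoka {A T Q R : Matrix d d ℂ} (hA : 0 ≤ A) (hA1 : A ≤ 1) (hT : 0 ≤ T)
    (hQ : Q = CFC.sqrt (A + T)) (hR : IsSelfAdjoint R) (hQR : Q * R = 1) (hRQ : R * Q = 1) :
    1 - R * A * R ≤ (2 : ℝ) • (1 - A) + (4 : ℝ) • T := by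
  have hS : 0 ≤ A + T := add_nonneg hA hT
  have hQQ : Q * Q = A + T := by rw [hQ]; exact CFC.sqrt_mul_sqrt_self _ hS
  have hAQ : A ≤ Q := hQ ▸ le_sqrt_of_le hA hA1 (le_add_of_nonneg_right hT)
  have h1 : 1 - R * A * R = R * T * R := by
    have : R * (A + T) * R = 1 := by
      rw [← hQQ, ← mul_assoc, hRQ, one_mul, hQR]
    rw [← this, mul_add, add_mul]
    abel
  have hR1 : IsSelfAdjoint (R - 1) := hR.sub (IsSelfAdjoint.one _)
  have hR2 : IsSelfAdjoint (R - 2 • 1) := by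
    simp [IsSelfAdjoint, hR.star_eq]
  have h2 : 0 ≤ (R - 2 • 1) * T * (R - 2 • 1) := hR2.conjugate_nonneg hT
  have h3 : 0 ≤ (R - 1) * A * (R - 1) := hR1.conjugate_nonneg hA
  have h4 : (R - 1) * (A + T) * (R - 1) = 1 - 2 • Q + (A + T) := by
    rw [← hQQ]
    have e : (R - 1) * (Q * Q) * (R - 1) = (R * Q - Q) * (Q * R - Q) := by noncomm_ring
    rw [e, hQR, hRQ]
    noncomm_ring
  rw [h1, ← sub_nonneg]
  -- The slack is a sum of three positive terms. The identity follows by expanding `(R - 1) * (A +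
  -- T) * (R - 1) = (1 - Q) ^ 2`.
  have h5 : (2 : ℝ) • (1 - A) + (4 : ℝ) • T - R * T * R =
      (R - 2 • 1) * T * (R - 2 • 1) + 2 • ((R - 1) * A * (R - 1)) + 4 • (Q - A) := by
    have e1 : (R - 2 • 1) * T * (R - 2 • 1) = 2 • ((R - 1) * T * (R - 1)) + 2 • T - R * T * R := by
      noncomm_ring
    have e2 : (R - 1) * T * (R - 1) = 1 - 2 • Q + (A + T) - (R - 1) * A * (R - 1) := by
      rw [← h4]; noncomm_ring
    rw [e1, e2]
    simp only [two_smul, ← Nat.cast_smul_eq_nsmul ℝ]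
    push_cast
    module
  rw [h5]
  exact add_nonneg (add_nonneg h2 (nsmul_nonneg h3 2)) (nsmul_nonneg (sub_nonneg.mpr hAQ) 4)

/-- The square-root measurement for positive operators `T (m, l)`, coarse-grained over `l`. -/
lemma exists_sqrt_measurement {M L : Type*} [Fintype M] [Fintype L] [DecidableEq M]
    [Nonempty M] [Nonempty L] (T : M × L → Matrix d d ℂ) (hT : ∀ k, 0 ≤ T k) (hT1 : ∀ k, T k ≤ 1)
    {ε : ℝ} (hε : 0 < ε) :
    ∃ Λ : M → Matrix d d ℂ, IsPOVM Λ ∧ ∀ m l,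
      1 - Λ m ≤ (2 : ℝ) • (1 - T (m, l)) + (4 : ℝ) • (∑ k, T k - T (m, l) + ε • 1) := by
  classical
  -- The term `ε • 1` makes `S` invertible. It is later spread evenly over the outcomes, so that the
  -- measurement sums to 1 exactly.
  set S : Matrix d d ℂ := ∑ k, T k + ε • 1 with hSdef
  have hε1 : 0 ≤ ε • (1 : Matrix d d ℂ) := smul_nonneg hε.le zero_le_one
  have hS : 0 ≤ S := add_nonneg (Finset.sum_nonneg fun k _ => hT k) hε1
  have hSpd : S.PosDef := by
    refine Matrix.PosDef.posSemidef_add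
      (Matrix.nonneg_iff_posSemidef.mp (Finset.sum_nonneg fun k _ => hT k)) ?_
    exact Matrix.PosDef.one.smul hε
  set Q := CFC.sqrt S with hQdef
  have hQ0 : 0 ≤ Q := CFC.sqrt_nonneg S
  have hQQ : Q * Q = S := CFC.sqrt_mul_sqrt_self _ hS
  have hQu : IsUnit Q := by
    have : IsUnit (Q * Q) := hQQ ▸ hSpd.isUnit
    exact ((Commute.refl Q).isUnit_mul_iff.mp this).1
  have hdet : IsUnit Q.det := (Matrix.isUnit_iff_isUnit_det Q).mp hQu
  set R := Q⁻¹
  have hR0 : 0 ≤ R := (Matrix.nonneg_iff_posSemidef.mp hQ0).inv.nonneg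
  have hR : IsSelfAdjoint R := hR0.isSelfAdjoint
  have hQR : Q * R = 1 := Matrix.mul_nonsing_inv Q hdet
  have hRQ : R * Q = 1 := Matrix.nonsing_inv_mul Q hdet
  have hcard : (0 : ℝ) < Fintype.card (M × L) := by exact_mod_cast Fintype.card_pos
  set η : ℝ := ε / Fintype.card (M × L) with hη
  have hη0 : 0 < η := by positivity
  have hη1 : 0 ≤ η • (1 : Matrix d d ℂ) := smul_nonneg hη0.le zero_le_one
  have hterm (k : M × L) : 0 ≤ R * (T k + η • 1) * R :=
    hR.conjugate_nonneg (add_nonneg (hT k) hη1)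
  refine ⟨fun m => ∑ l, R * (T (m, l) + η • 1) * R, ⟨fun m => ?_, ?_⟩, fun m l => ?_⟩
  · exact Matrix.nonneg_iff_posSemidef.mp (Finset.sum_nonneg fun l _ => hterm (m, l))
  · rw [← Fintype.sum_prod_type' (fun m l => R * (T (m, l) + η • 1) * R)]
    rw [← Finset.sum_mul, ← Finset.mul_sum, Finset.sum_add_distrib, Finset.sum_const,
      Finset.card_univ, ← Nat.cast_smul_eq_nsmul ℝ, smul_smul, hη, mul_div_cancel₀ _ hcard.ne',
      ← hSdef, ← hQQ, ← mul_assoc, hRQ, one_mul, hQR]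
  · have h1 : R * T (m, l) * R ≤ ∑ l, R * (T (m, l) + η • 1) * R := by
      refine le_trans ?_ (Finset.single_le_sum (fun l _ => hterm (m, l)) (Finset.mem_univ l))
      exact IsSelfAdjoint.conjugate_le_conjugate (le_add_of_nonneg_right hη1) hR
    refine (sub_le_sub_left h1 1).trans ?_
    have hrest : 0 ≤ ∑ k, T k - T (m, l) :=
      sub_nonneg.mpr (Finset.single_le_sum (fun k _ => hT k) (Finset.mem_univ (m, l)))
    refine hayashi_nagaoka (Q := Q) (hT _) (hT1 _) (add_nonneg hrest hε1) ?_ hR hQR hRQ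
    rw [hQdef, hSdef]
    congr 1
    abel

/-- A union bound for two projections that need not commute. The slack is `(2 - P) * (1 - E) * (2 -
P) + 2 * (1 - P) * E * (1 - P)`. -/
lemma one_sub_mul_mul_le {P E : Matrix d d ℂ} (hP : IsStarProjection P)
    (hE : IsStarProjection E) :
    1 - P * E * P ≤ (3 : ℝ) • (1 - P) + (2 : ℝ) • (1 - E) := by
  have hP' : IsStarProjection (1 - P) := hP.one_sub
  have hE' : IsStarProjection (1 - E) := hE.one_sub
  have hr : IsSelfAdjoint ((2 : ℕ) • (1 : Matrix d d ℂ) - P) := by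
    simp [IsSelfAdjoint, hP.isSelfAdjoint.star_eq]
  have h1 : 0 ≤ (2 • 1 - P) * (1 - E) * (2 • 1 - P) :=
    hr.conjugate_nonneg hE'.nonneg
  have h2 : 0 ≤ (1 - P) * E * (1 - P) := hP'.isSelfAdjoint.conjugate_nonneg hE.nonneg
  have hPP : P * P = P := hP.isIdempotentElem
  rw [← sub_nonneg]
  have : (3 : ℝ) • (1 - P) + (2 : ℝ) • (1 - E) - (1 - P * E * P) =
      (2 • 1 - P) * (1 - E) * (2 • 1 - P) + 2 • ((1 - P) * E * (1 - P)) := by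
    have e1 : (2 • 1 - P) * (1 - E) * (2 • 1 - P) =
        4 • 1 - 4 • P + P * P - 4 • E + 2 • (P * E) + 2 • (E * P) - P * E * P := by
      noncomm_ring
    have e2 : (1 - P) * E * (1 - P) = E - P * E - E * P + P * E * P := by
      noncomm_ring
    rw [e1, e2, hPP]
    simp only [← Nat.cast_smul_eq_nsmul ℝ]
    push_cast
    module
  rw [this]
  exact add_nonneg h1 (nsmul_nonneg h2 2)

end OperatorInequalities

/-! ### Explicit diagonalizations and entropy. -/

section Diagonalization

open scoped MatrixOrder

variable {d : Type*} [Fintype d] [DecidableEq d]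

/-- The matrix `W diag(a) W*` with real eigenvalues `a` in the basis of the columns of `W`. -/
def conjDiag (W : Matrix d d ℂ) (a : d → ℝ) : Matrix d d ℂ :=
  W * Matrix.diagonal (fun i => (a i : ℂ)) * W.conjTranspose

lemma conjDiag_mul {W : Matrix d d ℂ} (hW : W.conjTranspose * W = 1) (a b : d → ℝ) :
    conjDiag W a * conjDiag W b = conjDiag W (fun i => a i * b i) := by
  simp only [conjDiag, Complex.ofReal_mul]
  rw [← Matrix.diagonal_mul_diagonal]
  calc _ = W * Matrix.diagonal (fun i => (a i : ℂ)) * (W.conjTranspose * W) *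
        Matrix.diagonal (fun i => (b i : ℂ)) * W.conjTranspose := by simp only [mul_assoc]
    _ = _ := by rw [hW]; simp only [mul_assoc, one_mul]

lemma conjDiag_const {W : Matrix d d ℂ} (hW : W.conjTranspose * W = 1) (c : ℝ) :
    conjDiag W (fun _ => c) = c • 1 := by
  have h : Matrix.diagonal (fun _ : d => (c : ℂ)) = (c : ℂ) • 1 := by
    rw [Matrix.smul_one_eq_diagonal]
  rw [conjDiag, h, Matrix.mul_smul, mul_one, Matrix.smul_mul,
    mul_eq_one_comm.mp hW, Complex.coe_smul]

lemma conjDiag_sub (W : Matrix d d ℂ) (a b : d → ℝ) :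
    conjDiag W a - conjDiag W b = conjDiag W (fun i => a i - b i) := by
  simp only [conjDiag, Complex.ofReal_sub, ← Matrix.diagonal_sub, mul_sub, sub_mul]

lemma conjDiag_nonneg (W : Matrix d d ℂ) {a : d → ℝ} (ha : ∀ i, 0 ≤ a i) : 0 ≤ conjDiag W a := by
  refine Matrix.nonneg_iff_posSemidef.mpr (Matrix.PosSemidef.mul_mul_conjTranspose_same ?_ W)
  exact Matrix.PosSemidef.diagonal fun i => by simpa using ha i

lemma conjDiag_mono (W : Matrix d d ℂ) {a b : d → ℝ} (h : ∀ i, a i ≤ b i) :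
    conjDiag W a ≤ conjDiag W b := by
  rw [← sub_nonneg, conjDiag_sub]
  exact conjDiag_nonneg W fun i => sub_nonneg.mpr (h i)

lemma trace_conjDiag {W : Matrix d d ℂ} (hW : W.conjTranspose * W = 1) (a : d → ℝ) :
    (conjDiag W a).trace = ((∑ i, a i : ℝ) : ℂ) := by
  rw [conjDiag, Matrix.trace_mul_comm, ← mul_assoc, hW, one_mul, Matrix.trace_diagonal]
  push_cast
  rfl

lemma traceForm_conjDiag {W : Matrix d d ℂ} (hW : W.conjTranspose * W = 1) (a b : d → ℝ) :
    traceForm (conjDiag W a) (conjDiag W b) = ∑ i, a i * b i := by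
  rw [traceForm_apply, conjDiag_mul hW, trace_conjDiag hW, Complex.ofReal_re]

/-- The spectral projection of `W diag(a) W*` for the eigenvectors with index in `E`. -/
lemma isStarProjection_conjDiag {W : Matrix d d ℂ} (hW : W.conjTranspose * W = 1)
    (E : d → Prop) [DecidablePred E] :
    IsStarProjection (conjDiag W fun i => if E i then 1 else 0) where
  isIdempotentElem := by
    rw [IsIdempotentElem, conjDiag_mul hW]
    congr 1
    ext i
    split_ifs <;> simp
  isSelfAdjoint := (conjDiag_nonneg W fun i => by split_ifs <;> simp).isSelfAdjoint

lemma exists_eq_conjDiag {A : Matrix d d ℂ} (hA : 0 ≤ A) :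
    ∃ (W : Matrix d d ℂ) (a : d → ℝ), W.conjTranspose * W = 1 ∧ (∀ i, 0 ≤ a i) ∧
      A = conjDiag W a := by
  have hA' := Matrix.nonneg_iff_posSemidef.mp hA
  refine ⟨hA'.1.eigenvectorUnitary, hA'.1.eigenvalues, ?_, hA'.eigenvalues_nonneg, ?_⟩
  · exact Unitary.coe_star_mul_self hA'.1.eigenvectorUnitary
  · conv_lhs => rw [hA'.1.spectral_theorem]
    rfl

/-- The Shannon entropy, in bits, of a finite family of weights. -/
def shannonEntropy {V : Type*} [Fintype V] (q : V → ℝ) : ℝ := -∑ v, q v * Real.logb 2 (q v)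

/-- Any diagonalization may be used, because the roots of the characteristic polynomial determine
the eigenvalues with multiplicity. -/
lemma vonNeumannEntropy_conjDiag {W : Matrix d d ℂ} (hW : W.conjTranspose * W = 1) (a : d → ℝ) :
    vonNeumannEntropy (conjDiag W a) = shannonEntropy a := by
  have hA : (conjDiag W a).IsHermitian := by
    refine Matrix.isHermitian_mul_mul_conjTranspose _ ?_
    exact Matrix.isHermitian_diagonal_of_self_adjoint _ (by ext i; simp)
  have hroots : Multiset.map (fun i => ((hA.eigenvalues i : ℝ) : ℂ)) Finset.univ.val =
      Multiset.map (fun i => ((a i : ℝ) : ℂ)) Finset.univ.val := by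
    have h1 := hA.roots_charpoly_eq_eigenvalues
    have h2 : (conjDiag W a).charpoly = ∏ i, (Polynomial.X - Polynomial.C (a i : ℂ)) := by
      rw [conjDiag, Matrix.charpoly_mul_comm, ← mul_assoc, hW, one_mul, Matrix.charpoly_diagonal]
    rw [h2, Polynomial.roots_prod _ _
      (by simp [Finset.prod_ne_zero_iff, Polynomial.X_sub_C_ne_zero])] at h1
    simp only [Polynomial.roots_X_sub_C, Multiset.bind_singleton] at h1
    exact h1.symm
  have htrace : ((conjDiag W a * cfc (Real.logb 2) (conjDiag W a)).trace).re =
      ∑ i, hA.eigenvalues i * Real.logb 2 (hA.eigenvalues i) := by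
    have hU := Unitary.coe_star_mul_self hA.eigenvectorUnitary
    have e1 : conjDiag W a = conjDiag hA.eigenvectorUnitary hA.eigenvalues := by
      conv_lhs => rw [hA.spectral_theorem]
      rfl
    have e2 : cfc (Real.logb 2) (conjDiag W a) =
        conjDiag hA.eigenvectorUnitary (fun i => Real.logb 2 (hA.eigenvalues i)) := by
      rw [hA.cfc_eq]
      rfl
    rw [e2]
    nth_rewrite 1 [e1]
    exact traceForm_conjDiag hU _ _
  rw [vonNeumannEntropy, htrace, shannonEntropy]
  have := congrArg (fun s => (s.map (fun z : ℂ => z.re * Real.logb 2 z.re)).sum) hroots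
  simp only [Multiset.map_map, Function.comp_def, Complex.ofReal_re] at this
  exact congrArg Neg.neg this

end Diagonalization

/-! ### Tensor products of matrices indexed by words. -/

section TensorPowers

open scoped MatrixOrder

variable {ι B V : Type*} [Fintype ι]

/-- The tensor product of the matrices `A i`. -/
def piTensor (A : ι → Matrix B B ℂ) : Matrix (ι → B) (ι → B) ℂ :=
  Matrix.of fun b b' => ∏ i, A i (b i) (b' i)

lemma piTensor_conjTranspose (A : ι → Matrix B B ℂ) :
    (piTensor A).conjTranspose = piTensor fun i => (A i).conjTranspose := by
  ext b b'
  simp [piTensor, Matrix.conjTranspose_apply]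

lemma piTensor_diagonal [DecidableEq B] (a : ι → B → ℂ) :
    piTensor (fun i => Matrix.diagonal (a i)) = Matrix.diagonal fun b => ∏ i, a i (b i) := by
  ext b b'
  simp only [piTensor, Matrix.of_apply, Matrix.diagonal_apply]
  by_cases h : b = b'
  · simp [h]
  · obtain ⟨i, hi⟩ := Function.ne_iff.mp h
    rw [if_neg h]
    exact Finset.prod_eq_zero (Finset.mem_univ i) (by simp [hi])

lemma piTensor_one [DecidableEq B] : piTensor (fun _ : ι => (1 : Matrix B B ℂ)) = 1 := by
  simpa using piTensor_diagonal (fun (_ : ι) (_ : B) => (1 : ℂ))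

lemma sum_piTensor [DecidableEq ι] [Fintype V] (A : ι → V → Matrix B B ℂ) :
    ∑ v : ι → V, piTensor (fun i => A i (v i)) = piTensor fun i => ∑ v, A i v := by
  ext b b'
  simp only [piTensor, Matrix.of_apply, Matrix.sum_apply]
  rw [← Fintype.prod_sum (fun i v => A i v (b i) (b' i))]

variable [DecidableEq ι] [Fintype B]

lemma piTensor_mul (A A' : ι → Matrix B B ℂ) :
    piTensor A * piTensor A' = piTensor fun i => A i * A' i := by
  ext b b'
  simp only [piTensor, Matrix.mul_apply, Matrix.of_apply, ← Finset.prod_mul_distrib]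
  rw [← Fintype.prod_sum (fun i j => A i (b i) j * A' i j (b' i))]

/-- The eigenvalues of a tensor product are indexed by words, which reduces quantum typicality to
the classical law of large numbers. -/
lemma piTensor_conjDiag [DecidableEq B] (W : ι → Matrix B B ℂ) (a : ι → B → ℝ) :
    piTensor (fun i => conjDiag (W i) (a i)) =
      conjDiag (piTensor W) (fun b => ∏ i, a i (b i)) := by
  simp only [conjDiag, piTensor_conjTranspose, Complex.ofReal_prod]
  rw [← piTensor_diagonal (fun i j => (a i j : ℂ)), piTensor_mul, piTensor_mul]

lemma piTensor_isometry [DecidableEq B] {W : ι → Matrix B B ℂ}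
    (hW : ∀ i, (W i).conjTranspose * W i = 1) :
    (piTensor W).conjTranspose * piTensor W = 1 := by
  rw [piTensor_conjTranspose, piTensor_mul]
  simp [hW, piTensor_one]

lemma piTensor_nonneg [DecidableEq B] {A : ι → Matrix B B ℂ} (hA : ∀ i, 0 ≤ A i) :
    0 ≤ piTensor A := by
  choose W a _ ha hWa using fun i => exists_eq_conjDiag (hA i)
  rw [show A = fun i => conjDiag (W i) (a i) from funext hWa, piTensor_conjDiag]
  exact conjDiag_nonneg _ fun b => Finset.prod_nonneg fun i _ => ha i _

end TensorPowers

/-! ### Typical projections and tests. -/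

section Typicality

open scoped MatrixOrder

/-- In logarithms the event says that the empirical mean of `log (b / a)` exceeds its expectation
`μ` by `δ`. Positivity on the support of `r` is enough, since words of weight zero do not count. -/
lemma sum_prodWeight_atypical_le {V : Type*} [Fintype V] {r : V → ℝ} (hr0 : ∀ v, 0 ≤ r v)
    (hr : ∑ v, r v = 1) (a b : V → ℝ) (ha : ∀ v, 0 < r v → 0 < a v)
    (hb : ∀ v, 0 < r v → 0 < b v) {μ : ℝ}
    (hμ : ∑ v, r v * (Real.logb 2 (b v) - Real.logb 2 (a v)) = μ) {δ : ℝ} (hδ : 0 < δ) :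
    ∃ C : ℝ, ∀ n : ℕ, 0 < n →
      ∑ c : Fin n → V, (if (∏ i, a (c i)) * (2 : ℝ) ^ (n * (μ + δ)) < ∏ i, b (c i)
        then prodWeight r c else 0) ≤ C / n := by
  refine ⟨(∑ v, r v * (Real.logb 2 (b v) - Real.logb 2 (a v) -
    ∑ v, r v * (Real.logb 2 (b v) - Real.logb 2 (a v))) ^ 2) / δ ^ 2, fun n hn => ?_⟩
  have h := sum_prodWeight_le_of_deviation (ι := Fin n) hr0 hr
    (fun v => Real.logb 2 (b v) - Real.logb 2 (a v)) hδ (by simpa using hn)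
    (fun c => (∏ i, a (c i)) * (2 : ℝ) ^ (n * (μ + δ)) < ∏ i, b (c i)) ?_
  · rwa [Fintype.card_fin] at h
  intro c hc hpos
  have ha' : 0 < ∏ i, a (c i) := Finset.prod_pos fun i _ => ha _ (hpos i)
  have hlog := Real.logb_lt_logb one_lt_two (by positivity) hc
  rw [Real.logb_mul ha'.ne' (by positivity), Real.logb_rpow (by norm_num) (by norm_num),
    Real.logb_prod _ _ fun i _ => (ha _ (hpos i)).ne',
    Real.logb_prod _ _ fun i _ => (hb _ (hpos i)).ne'] at hlog
  rw [hμ]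
  refine le_trans ?_ (le_abs_self _)
  simp only [Finset.sum_sub_distrib, Finset.sum_const, Finset.card_univ, Fintype.card_fin,
    nsmul_eq_mul]
  linarith

lemma traceForm_one_sub_conjDiag {d : Type*} [Fintype d] [DecidableEq d] {W : Matrix d d ℂ}
    (hW : W.conjTranspose * W = 1) (E : d → Prop) [DecidablePred E] (a : d → ℝ) :
    traceForm (1 - conjDiag W fun i => if E i then 0 else 1) (conjDiag W a) =
      ∑ i, if E i then a i else 0 := by
  rw [show (1 : Matrix d d ℂ) = conjDiag W fun _ => 1 by rw [conjDiag_const hW, one_smul],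
    conjDiag_sub, traceForm_conjDiag hW]
  refine Finset.sum_congr rfl fun i _ => ?_
  split_ifs <;> simp

variable {U B : Type*} [Fintype U] [Fintype B] [DecidableEq B]

/-- Tests for the blocks `A u` of a classical-quantum state against the product of its marginals,
at an exponent arbitrarily close to the mutual information. -/
lemma exists_typical_tests {A : U → Matrix B B ℂ} {q : U → ℝ} {W : U → Matrix B B ℂ}
    {α : U → B → ℝ} {W₀ : Matrix B B ℂ} {l : B → ℝ}
    (hW : ∀ u, (W u).conjTranspose * W u = 1) (hα : ∀ u k, 0 ≤ α u k)
    (hA : ∀ u, A u = conjDiag (W u) (α u)) (hW₀ : W₀.conjTranspose * W₀ = 1)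
    (hl : ∀ k, 0 ≤ l k) (hAl : ∑ u, A u = conjDiag W₀ l) (hq : ∀ u, ∑ k, α u k = q u)
    (hq1 : ∑ u, q u = 1) {δ : ℝ} (hδ : 0 < δ) :
    ∃ C : ℝ, ∀ n : ℕ, 0 < n → ∃ T : (Fin n → U) → Matrix (Fin n → B) (Fin n → B) ℂ,
      (∀ v, 0 ≤ T v ∧ T v ≤ 1) ∧
      ∑ v, traceForm (1 - T v) (piTensor fun i => A (v i)) ≤ C / n ∧
      ∑ v, prodWeight q v * traceForm (T v) (∑ v' : Fin n → U, piTensor fun i => A (v' i)) ≤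
        (2 : ℝ) ^ (-(n * (shannonEntropy q + shannonEntropy l -
          shannonEntropy (fun x : U × B => α x.1 x.2) - 2 * δ))) := by
  set HU := shannonEntropy q with hHU
  set HB := shannonEntropy l with hHB
  set HUB := shannonEntropy (fun x : U × B => α x.1 x.2) with hHUB
  have hq0 (u : U) : 0 ≤ q u := hq u ▸ Finset.sum_nonneg fun k _ => hα u k
  have hα1 : ∑ x : U × B, α x.1 x.2 = 1 := by
    rw [Fintype.sum_prod_type]
    simp only [hq, hq1]
  have hαq (u : U) (k : B) : α u k ≤ q u :=
    hq u ▸ Finset.single_le_sum (fun k _ => hα u k) (Finset.mem_univ k)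
  have hl1 : ∑ k, l k = 1 := by
    have h1 : (∑ u, A u).trace = ((∑ u, q u : ℝ) : ℂ) := by
      rw [Matrix.trace_sum]
      push_cast
      refine Finset.sum_congr rfl fun u _ => ?_
      rw [hA, trace_conjDiag (hW u), hq]
    rw [hAl, trace_conjDiag hW₀, hq1] at h1
    exact_mod_cast h1
  -- Conditional typicality: the log-ratio of `q` to `α` has mean `H(UB) - H(U)`.
  obtain ⟨C₁, hC₁⟩ := sum_prodWeight_atypical_le (r := fun x : U × B => α x.1 x.2)
    (fun x => hα _ _) hα1 (fun x => α x.1 x.2) (fun x => q x.1) (fun x h => h)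
    (fun x h => h.trans_le (hαq _ _)) (μ := HUB - HU) (by
      simp only [mul_sub, Finset.sum_sub_distrib]
      rw [Fintype.sum_prod_type]
      simp only [← Finset.sum_mul, hq]
      rw [hHU, hHUB, shannonEntropy, shannonEntropy]
      ring) hδ
  -- Typicality for the average state: the logarithm of its eigenvalues has mean `-H(B)`.
  obtain ⟨C₂, hC₂⟩ := sum_prodWeight_atypical_le hl hl1 (fun _ => 1) l (fun _ _ => one_pos)
    (fun _ h => h) (μ := -HB) (by simp [hHB, shannonEntropy]) hδ
  refine ⟨3 * C₂ + 2 * C₁, fun n hn => ?_⟩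
  set WV : (Fin n → U) → Matrix (Fin n → B) (Fin n → B) ℂ := fun v => piTensor fun i => W (v i)
  set W₀' : Matrix (Fin n → B) (Fin n → B) ℂ := piTensor fun _ => W₀
  have hWV (v : Fin n → U) : (WV v).conjTranspose * WV v = 1 :=
    piTensor_isometry fun i => hW (v i)
  have hW₀' : W₀'.conjTranspose * W₀' = 1 := piTensor_isometry fun _ => hW₀
  set αn : (Fin n → U) → (Fin n → B) → ℝ := fun v k => ∏ i, α (v i) (k i) with hαn
  have hAn (v : Fin n → U) : piTensor (fun i => A (v i)) = conjDiag (WV v) (αn v) := by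
    simp only [hA, piTensor_conjDiag]
    rfl
  have hAn0 (v : Fin n → U) : 0 ≤ piTensor (fun i => A (v i)) := by
    rw [hAn]
    exact conjDiag_nonneg _ fun k => Finset.prod_nonneg fun i _ => hα _ _
  have hsum : ∑ v : Fin n → U, piTensor (fun i => A (v i)) = conjDiag W₀' (prodWeight l) := by
    rw [sum_piTensor (fun _ : Fin n => A)]
    simp only [hAl, piTensor_conjDiag]
    rfl
  set E : (Fin n → U) → (Fin n → B) → Prop := fun v k =>
    αn v k * (2 : ℝ) ^ (n * (HUB - HU + δ)) < prodWeight q v with hE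
  set F : (Fin n → B) → Prop := fun k =>
    (∏ _i : Fin n, 1) * (2 : ℝ) ^ (n * (-HB + δ)) < prodWeight l k with hF
  classical
  set P : Matrix (Fin n → B) (Fin n → B) ℂ := conjDiag W₀' fun k => if F k then 0 else 1 with hP
  set Q : (Fin n → U) → Matrix (Fin n → B) (Fin n → B) ℂ :=
    fun v => conjDiag (WV v) fun k => if E v k then 0 else 1 with hQ
  have hPp : IsStarProjection P := by
    convert isStarProjection_conjDiag hW₀' (fun k => ¬ F k) using 3
    simp only [ite_not]
  have hQp (v : Fin n → U) : IsStarProjection (Q v) := by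
    convert isStarProjection_conjDiag (hWV v) (fun k => ¬ E v k) using 3
    simp only [ite_not]
  -- `P` removes the large eigenvalues of the average state, and `Q v` the relatively small
  -- eigenvalues of the block at `v`. The constants 3 and 2 are those of `one_sub_mul_mul_le`.
  refine ⟨fun v => P * Q v * P, fun v => ⟨?_, ?_⟩, ?_, ?_⟩
  · exact hPp.isSelfAdjoint.conjugate_nonneg (hQp v).nonneg
  · refine (IsSelfAdjoint.conjugate_le_conjugate (hQp v).le_one hPp.isSelfAdjoint).trans ?_
    rw [mul_one, hPp.isIdempotentElem]
    exact hPp.le_one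
  · have hle (v : Fin n → U) : traceForm (1 - P * Q v * P) (piTensor fun i => A (v i)) ≤
        3 * traceForm (1 - P) (piTensor fun i => A (v i)) +
          2 * traceForm (1 - Q v) (piTensor fun i => A (v i)) := by
      have := traceForm_mono_left (one_sub_mul_mul_le hPp (hQp v)) (hAn0 v)
      simpa only [map_add, map_smul, LinearMap.add_apply, LinearMap.smul_apply, smul_eq_mul]
        using this
    refine (Finset.sum_le_sum fun v _ => hle v).trans ?_
    rw [Finset.sum_add_distrib, ← Finset.mul_sum, ← Finset.mul_sum, ← map_sum, hsum, hP,
      traceForm_one_sub_conjDiag hW₀' F, add_div, mul_div_assoc, mul_div_assoc]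
    refine add_le_add (mul_le_mul_of_nonneg_left (hC₂ n hn) (by norm_num))
      (mul_le_mul_of_nonneg_left ?_ (by norm_num))
    refine le_trans (le_of_eq ?_) (hC₁ n hn)
    rw [← (Equiv.arrowProdEquivProdArrow (Fin n) (fun _ => U) (fun _ => B)).symm.sum_comp,
      Fintype.sum_prod_type]
    refine Finset.sum_congr rfl fun v _ => ?_
    rw [hAn, hQ, traceForm_one_sub_conjDiag (hWV v) (E v)]
    rfl
  -- Rank count: every eigenvector kept by `Q v` carries at least the fraction `2 ^ (-n (H(UB) -
  -- H(U) + δ))` of the total `prodWeight q v`. The factor `prodWeight q v` avoids a division by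
  -- zero.
  · have hcard (v : Fin n → U) : prodWeight q v * traceForm (Q v) 1 ≤
        prodWeight q v * (2 : ℝ) ^ (n * (HUB - HU + δ)) := by
      have h1 : traceForm (Q v) 1 = ∑ k, if E v k then (0 : ℝ) else 1 := by
        rw [show (1 : Matrix (Fin n → B) (Fin n → B) ℂ) = conjDiag (WV v) fun _ => 1 by
          rw [conjDiag_const (hWV v), one_smul], hQ, traceForm_conjDiag (hWV v)]
        simp
      have h2 : ∑ k, αn v k = prodWeight q v := by
        rw [hαn, prodWeight, ← Fintype.prod_sum (fun i k => α (v i) k)]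
        simp only [hq]
      rw [h1, Finset.mul_sum]
      calc ∑ k, prodWeight q v * (if E v k then (0 : ℝ) else 1)
          ≤ ∑ k, αn v k * (2 : ℝ) ^ (n * (HUB - HU + δ)) := by
            refine Finset.sum_le_sum fun k _ => ?_
            split_ifs with h
            · rw [mul_zero]
              exact mul_nonneg (Finset.prod_nonneg fun i _ => hα _ _) (by positivity)
            · rw [mul_one]
              exact not_lt.mp h
        _ = _ := by rw [← Finset.sum_mul, h2]
    have hPl : P * conjDiag W₀' (prodWeight l) * P ≤ (2 : ℝ) ^ (n * (-HB + δ)) • 1 := by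
      rw [hP, conjDiag_mul hW₀', conjDiag_mul hW₀', ← conjDiag_const hW₀']
      refine conjDiag_mono _ fun k => ?_
      have h0 : (0 : ℝ) ≤ (2 : ℝ) ^ (n * (-HB + δ)) := by positivity
      split_ifs with h
      · simpa using h0
      · simpa [hF] using h
    have hTl (v : Fin n → U) : prodWeight q v * traceForm (P * Q v * P)
        (conjDiag W₀' (prodWeight l)) ≤
        prodWeight q v * (2 : ℝ) ^ (-(n * (HU + HB - HUB - 2 * δ))) := by
      have e : traceForm (P * Q v * P) (conjDiag W₀' (prodWeight l)) =
          traceForm (Q v) (P * conjDiag W₀' (prodWeight l) * P) := by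
        rw [traceForm_apply, traceForm_apply, mul_assoc, mul_assoc, Matrix.trace_mul_comm]
        simp only [mul_assoc]
      have h1 := traceForm_mono_right hPl (hQp v).nonneg
      rw [map_smul, smul_eq_mul] at h1
      calc _ ≤ prodWeight q v * ((2 : ℝ) ^ (n * (-HB + δ)) * traceForm (Q v) 1) := by
            rw [e]
            exact mul_le_mul_of_nonneg_left h1 (prodWeight_nonneg hq0 v)
        _ = (2 : ℝ) ^ (n * (-HB + δ)) * (prodWeight q v * traceForm (Q v) 1) := by ring
        _ ≤ (2 : ℝ) ^ (n * (-HB + δ)) * (prodWeight q v * (2 : ℝ) ^ (n * (HUB - HU + δ))) :=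
            mul_le_mul_of_nonneg_left (hcard v) (by positivity)
        _ = prodWeight q v * ((2 : ℝ) ^ (n * (-HB + δ)) * (2 : ℝ) ^ (n * (HUB - HU + δ))) := by
            ring
        _ = _ := by
            rw [← Real.rpow_add two_pos]
            congr 2
            ring
    rw [hsum]
    refine (Finset.sum_le_sum fun v _ => hTl v).trans_eq ?_
    rw [← Finset.sum_mul, sum_prodWeight q hq1, one_mul]

end Typicality

/-! ### Random codes for a classical-quantum channel. -/

section RandomCoding

open scoped MatrixOrder

variable {V D M L : Type*} [Fintype V] [Fintype D] [DecidableEq D] [Fintype M] [DecidableEq M]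
  [Fintype L] [DecidableEq L]

/-- The expected error probability of a random code for a classical-quantum channel, decoded by
the square-root measurement for the tests `T`. The channel state is `(q v)⁻¹ • A v`. -/
lemma exists_random_coding_measurement [Nonempty M] [Nonempty L] {q : V → ℝ}
    (hq0 : ∀ v, 0 ≤ q v) (hq : ∑ v, q v = 1) {A : V → Matrix D D ℂ} (hA : ∀ v, 0 ≤ A v)
    (hAq : ∀ v, (A v).trace = q v) {T : V → Matrix D D ℂ} (hT : ∀ v, 0 ≤ T v ∧ T v ≤ 1)
    {a b ε : ℝ} (ha : ∑ v, traceForm (1 - T v) (A v) ≤ a)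
    (hb : ∑ v, q v * traceForm (T v) (∑ v', A v') ≤ b) (hε : 0 < ε) :
    ∃ Λ : (M × L → V) → M → Matrix D D ℂ, (∀ c, IsPOVM (Λ c)) ∧ ∀ m l,
      ∑ c, prodWeight q c * traceForm (1 - Λ c m) ((q (c (m, l)))⁻¹ • A (c (m, l))) ≤
        2 * a + 4 * (Fintype.card (M × L) * b + ε) := by
  choose Λ hΛ hΛle using fun c : M × L → V =>
    exists_sqrt_measurement (fun k => T (c k)) (fun k => (hT _).1) (fun k => (hT _).2) hε
  refine ⟨Λ, hΛ, fun m l => ?_⟩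
  set σ : V → Matrix D D ℂ := fun v => (q v)⁻¹ • A v with hσ
  have hσ0 (v : V) : 0 ≤ σ v := smul_nonneg (inv_nonneg.mpr (hq0 v)) (hA v)
  -- Where `q v = 0` the inverse defaults to 0, harmlessly: a positive matrix of trace zero
  -- vanishes.
  have hqσ (v : V) : q v • σ v = A v := by
    by_cases h : q v = 0
    · have h0 : A v = 0 := (Matrix.nonneg_iff_posSemidef.mp (hA v)).trace_eq_zero_iff.mp (by
        rw [hAq, h, Complex.ofReal_zero])
      rw [h, h0, zero_smul]
    · rw [hσ, smul_smul, mul_inv_cancel₀ h, one_smul]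
  have hqσ' (X : Matrix D D ℂ) (v : V) : q v * traceForm X (σ v) = traceForm X (A v) := by
    exact ((traceForm X).map_smul (q v) (σ v)).symm.trans (congrArg _ (hqσ v))
  set k₀ : M × L := (m, l)
  have hle (c : M × L → V) : prodWeight q c * traceForm (1 - Λ c m) (σ (c k₀)) ≤
      2 * (prodWeight q c * traceForm (1 - T (c k₀)) (σ (c k₀))) +
        4 * (∑ k ∈ Finset.univ.erase k₀, prodWeight q c * traceForm (T (c k)) (σ (c k₀)) +
          ε * (prodWeight q c * traceForm 1 (σ (c k₀)))) := by
    have h := mul_le_mul_of_nonneg_left (traceForm_mono_left (hΛle c m l) (hσ0 (c k₀)))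
      (prodWeight_nonneg hq0 c)
    have hs : ∑ k, T (c k) - T (c k₀) = ∑ k ∈ Finset.univ.erase k₀, T (c k) := by
      rw [← Finset.add_sum_erase _ _ (Finset.mem_univ k₀), add_sub_cancel_left]
    rw [hs] at h
    refine h.trans_eq ?_
    simp only [map_add, map_smul, LinearMap.add_apply, LinearMap.smul_apply, smul_eq_mul,
      LinearMap.map_sum₂, ← Finset.mul_sum]
    ring
  refine (Finset.sum_le_sum fun c _ => hle c).trans ?_
  rw [Finset.sum_add_distrib, ← Finset.mul_sum, ← Finset.mul_sum, Finset.sum_add_distrib,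
    ← Finset.mul_sum, Finset.sum_comm,
    sum_prodWeight_mul_apply hq k₀ fun v => traceForm (1 - T v) (σ v),
    sum_prodWeight_mul_apply hq k₀ fun v => traceForm 1 (σ v)]
  simp only [hqσ']
  have h1 : ∑ v, traceForm 1 (A v) = 1 := by
    simp only [traceForm_apply, one_mul, hAq, Complex.ofReal_re, hq]
  -- A false alarm: the word at `k` is independent of the transmitted one, so the state averages to
  -- `∑ v', A v'`.
  have h2 (k : M × L) (hk : k ∈ Finset.univ.erase k₀) :
      ∑ c : M × L → V, prodWeight q c * traceForm (T (c k)) (σ (c k₀)) ≤ b := by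
    rw [sum_prodWeight_mul_apply_apply hq (Finset.ne_of_mem_erase hk)
      fun v v' => traceForm (T v) (σ v')]
    simpa only [hqσ', ← Finset.mul_sum, ← map_sum] using hb
  have hb0 : 0 ≤ b := by
    refine le_trans (Finset.sum_nonneg fun v _ => ?_) hb
    exact mul_nonneg (hq0 v) (traceForm_nonneg (hT v).1 (Finset.sum_nonneg fun v _ => hA v))
  have h3 := (Finset.sum_le_card_nsmul _ _ _ h2)
  rw [nsmul_eq_mul] at h3
  have h4 : ((Finset.univ.erase k₀).card : ℝ) ≤ Fintype.card (M × L) := by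
    exact_mod_cast Finset.card_le_univ _
  have h5 := mul_le_mul_of_nonneg_right h4 hb0
  rw [h1]
  linarith

end RandomCoding

/-! ### Mutual covering by a truncated likelihood ratio. -/

section Covering

variable {V₁ V₂ : Type*} [Fintype V₁] [Fintype V₂]

/-- The truncated likelihood ratio of a joint distribution and the product of its marginals. -/
lemma exists_truncated_ratio {P : V₁ × V₂ → ℝ} (hP0 : ∀ v, 0 ≤ P v) (hP : ∑ v, P v = 1)
    {P₁ : V₁ → ℝ} {P₂ : V₂ → ℝ} (hP₁ : ∀ v₁, ∑ v₂, P (v₁, v₂) = P₁ v₁)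
    (hP₂ : ∀ v₂, ∑ v₁, P (v₁, v₂) = P₂ v₂) {K τ : ℝ} (hK : 0 ≤ K)
    (hτ : ∑ v : V₁ × V₂, (if P₁ v.1 * P₂ v.2 * K < P v then P v else 0) ≤ τ) :
    ∃ w : V₁ → V₂ → ℝ, (∀ v₁ v₂, 0 ≤ w v₁ v₂) ∧ (∀ v₁ v₂, w v₁ v₂ ≤ K) ∧
      (∀ v₁ v₂, P₂ v₂ * w v₁ v₂ ≤ (P₁ v₁)⁻¹ * P (v₁, v₂)) ∧
      (∀ v₁ v₂, P₁ v₁ * w v₁ v₂ ≤ (P₂ v₂)⁻¹ * P (v₁, v₂)) ∧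
      1 - τ ≤ ∑ v₁, ∑ v₂, P₁ v₁ * (P₂ v₂ * w v₁ v₂) := by
  have hP₁0 (v₁ : V₁) : 0 ≤ P₁ v₁ := hP₁ v₁ ▸ Finset.sum_nonneg fun _ _ => hP0 _
  have hP₂0 (v₂ : V₂) : 0 ≤ P₂ v₂ := hP₂ v₂ ▸ Finset.sum_nonneg fun _ _ => hP0 _
  have hle₁ (v₁ : V₁) (v₂ : V₂) : P (v₁, v₂) ≤ P₁ v₁ :=
    hP₁ v₁ ▸ Finset.single_le_sum (f := fun v₂ => P (v₁, v₂)) (fun _ _ => hP0 _)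
      (Finset.mem_univ v₂)
  have hle₂ (v₁ : V₁) (v₂ : V₂) : P (v₁, v₂) ≤ P₂ v₂ :=
    hP₂ v₂ ▸ Finset.single_le_sum (f := fun v₁ => P (v₁, v₂)) (fun _ _ => hP0 _)
      (Finset.mem_univ v₁)
  refine ⟨fun v₁ v₂ => if P₁ v₁ * P₂ v₂ * K < P (v₁, v₂) then 0 else
    P (v₁, v₂) / (P₁ v₁ * P₂ v₂), fun v₁ v₂ => ?_, fun v₁ v₂ => ?_, fun v₁ v₂ => ?_,
    fun v₁ v₂ => ?_, ?_⟩
  · dsimp only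
    split_ifs
    · exact le_rfl
    · exact div_nonneg (hP0 _) (mul_nonneg (hP₁0 _) (hP₂0 _))
  · dsimp only
    split_ifs with h
    · exact hK
    · exact div_le_of_le_mul₀ (mul_nonneg (hP₁0 _) (hP₂0 _)) hK (by linarith)
  · have h0 : 0 ≤ (P₁ v₁)⁻¹ * P (v₁, v₂) := mul_nonneg (inv_nonneg.mpr (hP₁0 _)) (hP0 _)
    dsimp only
    split_ifs
    · simpa using h0
    · by_cases h : P₂ v₂ = 0
      · simpa [h] using h0
      · rw [← div_div, mul_div_cancel₀ _ h, div_eq_inv_mul]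
  · have h0 : 0 ≤ (P₂ v₂)⁻¹ * P (v₁, v₂) := mul_nonneg (inv_nonneg.mpr (hP₂0 _)) (hP0 _)
    dsimp only
    split_ifs
    · simpa using h0
    · by_cases h : P₁ v₁ = 0
      · simpa [h] using h0
      · rw [mul_comm (P₁ v₁) (P₂ v₂), ← div_div, mul_div_cancel₀ _ h, div_eq_inv_mul]
  · rw [← Fintype.sum_prod_type' (fun v₁ v₂ => P₁ v₁ * (P₂ v₂ * _)), sub_le_iff_le_add, ← hP]
    refine le_trans ?_ (add_le_add_right hτ _)
    rw [← Finset.sum_add_distrib]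
    refine Finset.sum_le_sum fun v _ => ?_
    obtain ⟨v₁, v₂⟩ := v
    dsimp only
    split_ifs
    · simp
    · rw [add_zero]
      -- The ratio is 0 by default when a marginal vanishes, but then `P` vanishes there too and no
      -- mass is lost.
      by_cases h : P₁ v₁ * P₂ v₂ = 0
      · rcases mul_eq_zero.mp h with h | h
        · exact (hle₁ v₁ v₂).trans (by simp [h])
        · exact (hle₂ v₁ v₂).trans (by simp [h])
      · rw [← mul_assoc, mul_div_cancel₀ _ h]

variable {ι₁ ι₂ L₁ L₂ : Type*} [Fintype ι₁] [DecidableEq ι₁] [Fintype ι₂] [DecidableEq ι₂]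
  [Fintype L₁] [Fintype L₂]

/-- The second-moment bound behind the mutual covering lemma. -/
lemma sum_sq_covering_le [Nonempty L₁] [Nonempty L₂] {P₁ : V₁ → ℝ} {P₂ : V₂ → ℝ}
    (hP₁0 : ∀ v, 0 ≤ P₁ v) (hP₂0 : ∀ v, 0 ≤ P₂ v) (hP₁ : ∑ v, P₁ v = 1) (hP₂ : ∑ v, P₂ v = 1)
    {w : V₁ → V₂ → ℝ} {K τ : ℝ} (hw0 : ∀ v₁ v₂, 0 ≤ w v₁ v₂) (hwK : ∀ v₁ v₂, w v₁ v₂ ≤ K)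
    (hw₁ : ∀ v₁, ∑ v₂, P₂ v₂ * w v₁ v₂ ≤ 1) (hw₂ : ∀ v₂, ∑ v₁, P₁ v₁ * w v₁ v₂ ≤ 1)
    (hτ : 1 - τ ≤ ∑ v₁, ∑ v₂, P₁ v₁ * (P₂ v₂ * w v₁ v₂)) {a : L₁ → ι₁} {b : L₂ → ι₂}
    (ha : a.Injective) (hb : b.Injective) :
    ∑ c₁ : ι₁ → V₁, ∑ c₂ : ι₂ → V₂, prodWeight P₁ c₁ * (prodWeight P₂ c₂ *
      ((∑ l : L₁ × L₂, w (c₁ (a l.1)) (c₂ (b l.2))) / Fintype.card (L₁ × L₂) - 1) ^ 2) ≤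
      K / Fintype.card (L₁ × L₂) + 2 * τ := by
  classical
  have hp₁ := prodWeight_nonneg (ι := ι₁) hP₁0
  have hp₂ := prodWeight_nonneg (ι := ι₂) hP₂0
  have hs₁ := sum_prodWeight (ι := ι₁) P₁ hP₁
  have hs₂ := sum_prodWeight (ι := ι₂) P₂ hP₂
  have hK : 0 ≤ K := by
    obtain ⟨v₁⟩ : Nonempty V₁ := by
      by_contra h
      rw [not_nonempty_iff] at h
      simp at hP₁
    obtain ⟨v₂⟩ : Nonempty V₂ := by
      by_contra h
      rw [not_nonempty_iff] at h
      simp at hP₂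
    exact (hw0 v₁ v₂).trans (hwK v₁ v₂)
  set N : ℝ := (Fintype.card (L₁ × L₂) : ℝ) with hN
  have hN0 : 0 < N := by rw [hN]; exact_mod_cast Fintype.card_pos
  have hfirst (i : ι₁) (j : ι₂) : ∑ c₁ : ι₁ → V₁, ∑ c₂ : ι₂ → V₂,
      prodWeight P₁ c₁ * (prodWeight P₂ c₂ * w (c₁ i) (c₂ j)) =
      ∑ v₁, ∑ v₂, P₁ v₁ * (P₂ v₂ * w v₁ v₂) := by
    simp only [← Finset.mul_sum, sum_prodWeight_mul_apply hP₂ j (w _)]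
    exact sum_prodWeight_mul_apply hP₁ i fun v₁ => ∑ v₂, P₂ v₂ * w v₁ v₂
  have hfirst_le : ∑ v₁, ∑ v₂, P₁ v₁ * (P₂ v₂ * w v₁ v₂) ≤ 1 := by
    simp only [← Finset.mul_sum]
    rw [← hP₁]
    exact Finset.sum_le_sum fun v _ => mul_le_of_le_one_right (hP₁0 v) (hw₁ v)
  have hw₁0 (v : V₁) : 0 ≤ ∑ v₂, P₂ v₂ * w v v₂ :=
    Finset.sum_nonneg fun _ _ => mul_nonneg (hP₂0 _) (hw0 _ _)
  have hw₂0 (v : V₂) : 0 ≤ ∑ v₁, P₁ v₁ * w v₁ v :=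
    Finset.sum_nonneg fun _ _ => mul_nonneg (hP₁0 _) (hw0 _ _)
  -- Only the diagonal costs `K`. Pairs sharing one index cost no more than disjoint pairs: with the
  -- codebook of the shared index fixed, the two factors are independent with conditional means at
  -- most 1. Hence only the product of the bin sizes matters.
  have hsecond (l l' : L₁ × L₂) : ∑ c₁ : ι₁ → V₁, ∑ c₂ : ι₂ → V₂,
      prodWeight P₁ c₁ * (prodWeight P₂ c₂ *
        (w (c₁ (a l.1)) (c₂ (b l.2)) * w (c₁ (a l'.1)) (c₂ (b l'.2)))) ≤
      1 + if l = l' then K else 0 := by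
    by_cases h₂ : l.2 = l'.2
    · by_cases h₁ : l.1 = l'.1
      · have hl : l = l' := Prod.ext h₁ h₂
        rw [← hl, if_pos rfl]
        calc _ ≤ ∑ c₁ : ι₁ → V₁, ∑ c₂ : ι₂ → V₂, K * (prodWeight P₁ c₁ *
              (prodWeight P₂ c₂ * w (c₁ (a l.1)) (c₂ (b l.2)))) := by
              refine Finset.sum_le_sum fun c₁ _ => Finset.sum_le_sum fun c₂ _ => ?_
              have h := mul_le_mul_of_nonneg_right (hwK (c₁ (a l.1)) (c₂ (b l.2)))
                (mul_nonneg (mul_nonneg (hp₁ c₁) (hp₂ c₂)) (hw0 (c₁ (a l.1)) (c₂ (b l.2))))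
              linarith
          _ ≤ K * 1 := by
              simp only [← Finset.mul_sum (a := K), hfirst]
              exact mul_le_mul_of_nonneg_left hfirst_le hK
          _ ≤ 1 + K := by linarith
      · rw [if_neg (fun h => h₁ (congrArg Prod.fst h)), add_zero, Finset.sum_comm, ← hs₂]
        refine Finset.sum_le_sum fun c₂ _ => ?_
        have e : ∑ c₁ : ι₁ → V₁, prodWeight P₁ c₁ * (prodWeight P₂ c₂ *
            (w (c₁ (a l.1)) (c₂ (b l.2)) * w (c₁ (a l'.1)) (c₂ (b l'.2)))) =
            prodWeight P₂ c₂ * ((∑ v, P₁ v * w v (c₂ (b l.2))) *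
              ∑ v, P₁ v * w v (c₂ (b l'.2))) := by
          rw [← sum_prodWeight_mul_apply_mul_apply hP₁ (fun h => h₁ (ha h))
            (fun v => w v (c₂ (b l.2))) (fun v => w v (c₂ (b l'.2))), Finset.mul_sum]
          exact Finset.sum_congr rfl fun _ _ => by ring
        rw [e]
        exact mul_le_of_le_one_right (hp₂ c₂) (mul_le_one₀ (hw₂ _) (hw₂0 _) (hw₂ _))
    · rw [if_neg (fun h => h₂ (congrArg Prod.snd h)), add_zero, ← hs₁]
      refine Finset.sum_le_sum fun c₁ _ => ?_
      rw [← Finset.mul_sum, sum_prodWeight_mul_apply_mul_apply hP₂ (fun h => h₂ (hb h))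
        (w (c₁ (a l.1))) (w (c₁ (a l'.1)))]
      exact mul_le_of_le_one_right (hp₁ c₁) (mul_le_one₀ (hw₁ _) (hw₁0 _) (hw₁ _))
  have hexpand (c₁ : ι₁ → V₁) (c₂ : ι₂ → V₂) : prodWeight P₁ c₁ * (prodWeight P₂ c₂ *
      ((∑ l : L₁ × L₂, w (c₁ (a l.1)) (c₂ (b l.2))) / N - 1) ^ 2) =
      (∑ l : L₁ × L₂, ∑ l' : L₁ × L₂, prodWeight P₁ c₁ * (prodWeight P₂ c₂ *
        (w (c₁ (a l.1)) (c₂ (b l.2)) * w (c₁ (a l'.1)) (c₂ (b l'.2))))) / N ^ 2 -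
      2 / N * (∑ l : L₁ × L₂, prodWeight P₁ c₁ * (prodWeight P₂ c₂ *
        w (c₁ (a l.1)) (c₂ (b l.2)))) + prodWeight P₁ c₁ * prodWeight P₂ c₂ := by
    simp only [← Finset.mul_sum, ← Finset.sum_mul]
    field_simp
    ring
  simp only [hexpand, Finset.sum_add_distrib, Finset.sum_sub_distrib, ← Finset.sum_div,
    ← Finset.mul_sum (a := 2 / N)]
  have hE1 : ∑ c₁ : ι₁ → V₁, ∑ c₂ : ι₂ → V₂, ∑ l : L₁ × L₂,
      prodWeight P₁ c₁ * (prodWeight P₂ c₂ * w (c₁ (a l.1)) (c₂ (b l.2))) =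
      N * ∑ v₁, ∑ v₂, P₁ v₁ * (P₂ v₂ * w v₁ v₂) := by
    rw [Finset.sum_congr rfl fun c₁ _ => Finset.sum_comm, Finset.sum_comm,
      Finset.sum_congr rfl fun l _ => hfirst _ _]
    simp [hN]
  have hE2 : ∑ c₁ : ι₁ → V₁, ∑ c₂ : ι₂ → V₂, ∑ l : L₁ × L₂, ∑ l' : L₁ × L₂,
      prodWeight P₁ c₁ * (prodWeight P₂ c₂ *
        (w (c₁ (a l.1)) (c₂ (b l.2)) * w (c₁ (a l'.1)) (c₂ (b l'.2)))) ≤ N ^ 2 + N * K := by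
    rw [Finset.sum_congr rfl fun c₁ _ => Finset.sum_comm, Finset.sum_comm]
    calc _ ≤ ∑ l : L₁ × L₂, ∑ l' : L₁ × L₂, (1 + if l = l' then K else 0) := by
          refine Finset.sum_le_sum fun l _ => ?_
          rw [Finset.sum_congr rfl fun c₁ _ => Finset.sum_comm, Finset.sum_comm]
          exact Finset.sum_le_sum fun l' _ => hsecond l l'
      _ = _ := by
          simp only [Finset.sum_add_distrib, Finset.sum_ite_eq, Finset.mem_univ, if_true,
            Finset.sum_const, Finset.card_univ, nsmul_eq_mul, ← hN]
          ring
  have hE0 : ∑ c₁ : ι₁ → V₁, ∑ c₂ : ι₂ → V₂, prodWeight P₁ c₁ * prodWeight P₂ c₂ = 1 := by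
    simp only [← Finset.mul_sum, hs₂, mul_one, hs₁]
  rw [hE1, hE0]
  have h1 := (div_le_div_iff_of_pos_right (pow_pos hN0 2)).mpr hE2
  have h2 : (N ^ 2 + N * K) / N ^ 2 = 1 + K / N := by field_simp
  have h3 : 2 / N * (N * ∑ v₁, ∑ v₂, P₁ v₁ * (P₂ v₂ * w v₁ v₂)) =
      2 * ∑ v₁, ∑ v₂, P₁ v₁ * (P₂ v₂ * w v₁ v₂) := by field_simp
  rw [h2] at h1
  rw [h3]
  linarith

/-- A choice at least as good as the weighted average, up to the deviation of the total weight. -/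
lemma exists_le_weighted_average {L : Type*} [Fintype L] [Nonempty L] {w e s : L → ℝ}
    (hw : ∀ l, 0 ≤ w l) (he : ∀ l, e l ≤ 1) (hes : ∀ l, e l ≤ s l) (hs : ∀ l, 0 ≤ s l) :
    ∃ l, e l ≤ 4 * ((∑ l, w l) / Fintype.card L - 1) ^ 2 +
      2 * ((∑ l, w l * s l) / Fintype.card L) := by
  obtain ⟨l, -, hl⟩ := Finset.exists_min_image Finset.univ e Finset.univ_nonempty
  have hN : (0 : ℝ) < Fintype.card L := by exact_mod_cast Fintype.card_pos
  have hws : 0 ≤ (∑ l, w l * s l) / Fintype.card L :=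
    div_nonneg (Finset.sum_nonneg fun l _ => mul_nonneg (hw l) (hs l)) hN.le
  refine ⟨l, ?_⟩
  set z := (∑ l, w l) / Fintype.card L with hz
  have hmin : e l * z ≤ (∑ l, w l * s l) / Fintype.card L := by
    rw [hz, mul_div_assoc', div_le_div_iff_of_pos_right hN, mul_comm, Finset.sum_mul]
    exact Finset.sum_le_sum fun l' _ =>
      mul_le_mul_of_nonneg_left ((hl l' (Finset.mem_univ l')).trans (hes l')) (hw l')
  -- If `z ≥ 1/2`, the minimum is at most twice the weighted average. Otherwise `4 * (z - 1) ^ 2 >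
  -- 1` dominates the trivial bound `e l ≤ 1`.
  rcases le_or_gt (1 / 2) z with h | h
  · rcases le_or_gt (e l) 0 with h0 | h0
    · nlinarith [sq_nonneg (z - 1)]
    · nlinarith [sq_nonneg (z - 1), mul_le_mul_of_nonneg_left h h0.le]
  · nlinarith [he l]

end Covering

/-! ### Partial traces and product measurements. -/

section PartialTrace

open scoped MatrixOrder

variable {A B : Type*}

lemma traceRight_nonneg [Fintype B] {ρ : Matrix (A × B) (A × B) ℂ} (hρ : 0 ≤ ρ) : 0 ≤ traceRight ρ := by
  have h : traceRight ρ = ∑ b, ρ.submatrix (fun a => (a, b)) (fun a => (a, b)) := by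
    ext a a'
    simp [traceRight, Matrix.sum_apply]
  rw [h]
  exact Finset.sum_nonneg fun b _ => ((Matrix.nonneg_iff_posSemidef.mp hρ).submatrix _).nonneg

lemma traceLeft_nonneg [Fintype A] {ρ : Matrix (A × B) (A × B) ℂ} (hρ : 0 ≤ ρ) : 0 ≤ traceLeft ρ := by
  have h : traceLeft ρ = ∑ a, ρ.submatrix (fun b => (a, b)) (fun b => (a, b)) := by
    ext b b'
    simp [traceLeft, Matrix.sum_apply]
  rw [h]
  exact Finset.sum_nonneg fun b _ => ((Matrix.nonneg_iff_posSemidef.mp hρ).submatrix _).nonneg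

variable [Fintype A] [Fintype B]

lemma trace_traceRight (ρ : Matrix (A × B) (A × B) ℂ) : (traceRight ρ).trace = ρ.trace := by
  simp [Matrix.trace, traceRight, Fintype.sum_prod_type]

lemma trace_traceLeft (ρ : Matrix (A × B) (A × B) ℂ) : (traceLeft ρ).trace = ρ.trace := by
  simp [Matrix.trace, traceLeft, Fintype.sum_prod_type_right]

lemma traceForm_kronecker_one [DecidableEq B] (X : Matrix A A ℂ) (ρ : Matrix (A × B) (A × B) ℂ) :
    traceForm (X ⊗ₖ (1 : Matrix B B ℂ)) ρ = traceForm X (traceRight ρ) := by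
  rw [traceForm_apply, traceForm_apply]
  congr 1
  simp only [Matrix.trace, Matrix.diag_apply, Matrix.mul_apply, Fintype.sum_prod_type,
    Matrix.kroneckerMap_apply, Matrix.one_apply, traceRight, Matrix.of_apply, Finset.mul_sum,
    mul_ite, mul_one, mul_zero, ite_mul, zero_mul, Finset.sum_ite_eq, Finset.mem_univ, if_true]
  exact Finset.sum_congr rfl fun _ _ => Finset.sum_comm

lemma traceForm_one_kronecker [DecidableEq A] (X : Matrix B B ℂ) (ρ : Matrix (A × B) (A × B) ℂ) :
    traceForm ((1 : Matrix A A ℂ) ⊗ₖ X) ρ = traceForm X (traceLeft ρ) := by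
  rw [traceForm_apply, traceForm_apply]
  congr 1
  simp only [Matrix.trace, Matrix.diag_apply, Matrix.mul_apply, Fintype.sum_prod_type_right,
    Matrix.kroneckerMap_apply, Matrix.one_apply, traceLeft, Matrix.of_apply, Finset.mul_sum,
    ite_mul, one_mul, zero_mul, Finset.sum_ite_eq, Finset.mem_univ, if_true]
  exact Finset.sum_congr rfl fun _ _ => Finset.sum_comm

variable [DecidableEq A] [DecidableEq B]

/-- The union bound over the two receivers; the slack is `(1 - X) ⊗ₖ (1 - Y)`. -/
lemma one_sub_kronecker_le {X : Matrix A A ℂ} {Y : Matrix B B ℂ} (hX : X ≤ 1) (hY : Y ≤ 1) :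
    1 - X ⊗ₖ Y ≤ (1 - X) ⊗ₖ (1 : Matrix B B ℂ) + (1 : Matrix A A ℂ) ⊗ₖ (1 - Y) := by
  have h : 0 ≤ (1 - X) ⊗ₖ (1 - Y) :=
    ((Matrix.nonneg_iff_posSemidef.mp (sub_nonneg.mpr hX)).kronecker
      (Matrix.nonneg_iff_posSemidef.mp (sub_nonneg.mpr hY))).nonneg
  rw [← sub_nonneg]
  convert h using 1
  ext ⟨a, b⟩ ⟨a', b'⟩
  simp only [Matrix.sub_apply, Matrix.add_apply, Matrix.kroneckerMap_apply, Matrix.one_apply,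
    Prod.mk.injEq]
  by_cases h1 : a = a' <;> by_cases h2 : b = b' <;> simp [h1, h2] <;> ring

lemma IsPOVM.nonneg {M : Type*} [Fintype M] {Λ : M → Matrix A A ℂ} (h : IsPOVM Λ) (m : M) :
    0 ≤ Λ m :=
  (h.posSemidef m).nonneg

lemma IsPOVM.le_one {M : Type*} [Fintype M] {Λ : M → Matrix A A ℂ} (h : IsPOVM Λ) (m : M) :
    Λ m ≤ 1 :=
  h.sum_eq_one ▸ Finset.single_le_sum (fun m _ => h.nonneg m) (Finset.mem_univ m)

end PartialTrace

/-! ### One-shot broadcast codes. -/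

section BroadcastRandomCoding

open scoped MatrixOrder

variable {V₁ V₂ : Type*} [Fintype V₁] [Fintype V₂]

/-- A change of measure: `X` does not depend on `c₂`, so averaging the weight over `c₂ j` replaces
the independent law `P₂` by at most the conditional law of `v₂` given `c₁ i`, and the marginal
channel appears. -/
lemma sum_weighted_error_le {ι₁ ι₂ D : Type*} [Fintype ι₁] [DecidableEq ι₁] [Fintype ι₂]
    [DecidableEq ι₂] [Fintype D] {P₁ : V₁ → ℝ} {P₂ : V₂ → ℝ} (hP₁0 : ∀ v, 0 ≤ P₁ v)
    (hP₂ : ∑ v, P₂ v = 1) {P w : V₁ → V₂ → ℝ}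
    (hw : ∀ v₁ v₂, P₂ v₂ * w v₁ v₂ ≤ (P₁ v₁)⁻¹ * P v₁ v₂) {X : (ι₁ → V₁) → Matrix D D ℂ}
    (hX : ∀ c, 0 ≤ X c) {σ : V₁ → V₂ → Matrix D D ℂ} (hσ : ∀ v₁ v₂, 0 ≤ σ v₁ v₂) (i : ι₁)
    (j : ι₂) :
    ∑ c₁ : ι₁ → V₁, ∑ c₂ : ι₂ → V₂, prodWeight P₁ c₁ * (prodWeight P₂ c₂ *
      (w (c₁ i) (c₂ j) * traceForm (X c₁) (σ (c₁ i) (c₂ j)))) ≤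
    ∑ c₁ : ι₁ → V₁, prodWeight P₁ c₁ *
      traceForm (X c₁) ((P₁ (c₁ i))⁻¹ • ∑ v₂, P (c₁ i) v₂ • σ (c₁ i) v₂) := by
  refine Finset.sum_le_sum fun c₁ _ => ?_
  rw [← Finset.mul_sum, sum_prodWeight_mul_apply hP₂ j
    fun v₂ => w (c₁ i) v₂ * traceForm (X c₁) (σ (c₁ i) v₂)]
  refine mul_le_mul_of_nonneg_left ?_ (prodWeight_nonneg hP₁0 c₁)
  simp only [map_smul, map_sum, smul_eq_mul, Finset.mul_sum, ← mul_assoc]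
  exact Finset.sum_le_sum fun v₂ _ =>
    mul_le_mul_of_nonneg_right (hw _ _) (traceForm_nonneg (hX _) (hσ _ _))

lemma exists_le_of_sum_mul_le {C : Type*} [Fintype C] {p f : C → ℝ} (hp : ∀ c, 0 ≤ p c)
    (hp1 : ∑ c, p c = 1) {x : ℝ} (h : ∑ c, p c * f c ≤ x) : ∃ c, f c ≤ x := by
  by_contra! hc
  obtain ⟨c, -, hpos⟩ : ∃ c ∈ Finset.univ, 0 < p c := by
    refine Finset.exists_lt_of_sum_lt ?_
    simp [hp1]
  have hlt : ∑ c, p c * x < ∑ c, p c * f c :=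
    Finset.sum_lt_sum (fun c _ => mul_le_mul_of_nonneg_left (hc c).le (hp c))
      ⟨c, Finset.mem_univ c, mul_lt_mul_of_pos_left (hc c) hpos⟩
  rw [← Finset.sum_mul, hp1, one_mul] at hlt
  exact absurd h (not_le.mpr hlt)

/-- One-shot broadcast coding: choosing jointly likely pairs from two random codebooks, with
decoders that are good on average for the marginal channels, gives a broadcast code. -/
lemma exists_broadcast_code {D₁ D₂ M₁ M₂ L₁ L₂ : Type*} [Fintype D₁] [DecidableEq D₁]
    [Fintype D₂] [DecidableEq D₂] [Fintype M₁] [DecidableEq M₁] [Fintype M₂] [DecidableEq M₂]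
    [Fintype L₁] [DecidableEq L₁] [Nonempty L₁] [Fintype L₂] [DecidableEq L₂] [Nonempty L₂]
    {P : V₁ × V₂ → ℝ} (hP0 : ∀ v, 0 ≤ P v) (hP : ∑ v, P v = 1)
    {P₁ : V₁ → ℝ} {P₂ : V₂ → ℝ} (hP₁ : ∀ v₁, ∑ v₂, P (v₁, v₂) = P₁ v₁)
    (hP₂ : ∀ v₂, ∑ v₁, P (v₁, v₂) = P₂ v₂) {K τ : ℝ} (hK : 0 ≤ K)
    (hτ : ∑ v : V₁ × V₂, (if P₁ v.1 * P₂ v.2 * K < P v then P v else 0) ≤ τ)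
    {ρ : V₁ → V₂ → Matrix (D₁ × D₂) (D₁ × D₂) ℂ} (hρ : ∀ v₁ v₂, IsDensityMatrix (ρ v₁ v₂))
    {Λ : (M₁ × L₁ → V₁) → M₁ → Matrix D₁ D₁ ℂ} (hΛ : ∀ c, IsPOVM (Λ c))
    {Γ : (M₂ × L₂ → V₂) → M₂ → Matrix D₂ D₂ ℂ} (hΓ : ∀ c, IsPOVM (Γ c)) {η₁ η₂ : ℝ}
    (hη₁ : ∀ m l, ∑ c, prodWeight P₁ c * traceForm (1 - Λ c m) ((P₁ (c (m, l)))⁻¹ •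
      ∑ v₂, P (c (m, l), v₂) • traceRight (ρ (c (m, l)) v₂)) ≤ η₁)
    (hη₂ : ∀ m l, ∑ c, prodWeight P₂ c * traceForm (1 - Γ c m) ((P₂ (c (m, l)))⁻¹ •
      ∑ v₁, P (v₁, c (m, l)) • traceLeft (ρ v₁ (c (m, l)))) ≤ η₂) :
    ∃ (x₁ : M₁ → M₂ → V₁) (x₂ : M₁ → M₂ → V₂) (Λ' : M₁ → Matrix D₁ D₁ ℂ)
      (Γ' : M₂ → Matrix D₂ D₂ ℂ), IsPOVM Λ' ∧ IsPOVM Γ' ∧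
      ∑ m₁, ∑ m₂, (((1 - Λ' m₁ ⊗ₖ Γ' m₂) * ρ (x₁ m₁ m₂) (x₂ m₁ m₂)).trace).re ≤
        Fintype.card M₁ * (Fintype.card M₂ *
          (4 * (K / Fintype.card (L₁ × L₂) + 2 * τ) + 2 * (η₁ + η₂))) := by
  have hP₁0 (v₁ : V₁) : 0 ≤ P₁ v₁ := hP₁ v₁ ▸ Finset.sum_nonneg fun _ _ => hP0 _
  have hP₂0 (v₂ : V₂) : 0 ≤ P₂ v₂ := hP₂ v₂ ▸ Finset.sum_nonneg fun _ _ => hP0 _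
  have hP₁1 : ∑ v, P₁ v = 1 := by simpa only [Fintype.sum_prod_type, hP₁] using hP
  have hP₂1 : ∑ v, P₂ v = 1 := by simpa only [Fintype.sum_prod_type_right, hP₂] using hP
  obtain ⟨w, hw0, hwK, hw₁, hw₂, hwτ⟩ := exists_truncated_ratio hP0 hP hP₁ hP₂ hK hτ
  have hρ0 (v₁ : V₁) (v₂ : V₂) : 0 ≤ ρ v₁ v₂ := (hρ v₁ v₂).posSemidef.nonneg
  have hsum₁ (v₁ : V₁) : ∑ v₂, P₂ v₂ * w v₁ v₂ ≤ 1 := by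
    refine (Finset.sum_le_sum fun v₂ _ => hw₁ v₁ v₂).trans ?_
    rw [← Finset.mul_sum, hP₁]
    exact inv_mul_le_one
  have hsum₂ (v₂ : V₂) : ∑ v₁, P₁ v₁ * w v₁ v₂ ≤ 1 := by
    refine (Finset.sum_le_sum fun v₁ _ => hw₂ v₁ v₂).trans ?_
    rw [← Finset.mul_sum, hP₂]
    exact inv_mul_le_one
  set N : ℝ := (Fintype.card (L₁ × L₂) : ℝ) with hN
  have hN0 : 0 < N := by rw [hN]; exact_mod_cast Fintype.card_pos
  set err : (M₁ × L₁ → V₁) → (M₂ × L₂ → V₂) → M₁ → M₂ → L₁ × L₂ → ℝ := fun c₁ c₂ m₁ m₂ l =>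
    traceForm (1 - Λ c₁ m₁ ⊗ₖ Γ c₂ m₂) (ρ (c₁ (m₁, l.1)) (c₂ (m₂, l.2)))
  set s₁ : (M₁ × L₁ → V₁) → (M₂ × L₂ → V₂) → M₁ → M₂ → L₁ × L₂ → ℝ := fun c₁ c₂ m₁ m₂ l =>
    traceForm (1 - Λ c₁ m₁) (traceRight (ρ (c₁ (m₁, l.1)) (c₂ (m₂, l.2))))
  set s₂ : (M₁ × L₁ → V₁) → (M₂ × L₂ → V₂) → M₁ → M₂ → L₁ × L₂ → ℝ := fun c₁ c₂ m₁ m₂ l =>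
    traceForm (1 - Γ c₂ m₂) (traceLeft (ρ (c₁ (m₁, l.1)) (c₂ (m₂, l.2))))
  set W : (M₁ × L₁ → V₁) → (M₂ × L₂ → V₂) → M₁ → M₂ → L₁ × L₂ → ℝ := fun c₁ c₂ m₁ m₂ l =>
    w (c₁ (m₁, l.1)) (c₂ (m₂, l.2))
  have hΛ' (c : M₁ × L₁ → V₁) (m : M₁) : 0 ≤ 1 - Λ c m := sub_nonneg.mpr ((hΛ c).le_one m)
  have hΓ' (c : M₂ × L₂ → V₂) (m : M₂) : 0 ≤ 1 - Γ c m := sub_nonneg.mpr ((hΓ c).le_one m)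
  -- The sender's selection: the joint error is at most 1 and at most the sum of the receivers'
  -- separate errors, as `exists_le_weighted_average` requires.
  have hchoice (c₁ : M₁ × L₁ → V₁) (c₂ : M₂ × L₂ → V₂) (m₁ : M₁) (m₂ : M₂) :
      ∃ l, err c₁ c₂ m₁ m₂ l ≤ 4 * ((∑ l, W c₁ c₂ m₁ m₂ l) / N - 1) ^ 2 +
        2 * ((∑ l, W c₁ c₂ m₁ m₂ l * (s₁ c₁ c₂ m₁ m₂ l + s₂ c₁ c₂ m₁ m₂ l)) / N) := by
    refine exists_le_weighted_average (fun l => hw0 _ _) (fun l => ?_) (fun l => ?_) fun l => ?_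
    · have h0 : 0 ≤ Λ c₁ m₁ ⊗ₖ Γ c₂ m₂ :=
        (((hΛ c₁).posSemidef m₁).kronecker ((hΓ c₂).posSemidef m₂)).nonneg
      have h := traceForm_mono_left (sub_le_self 1 h0) (hρ0 (c₁ (m₁, l.1)) (c₂ (m₂, l.2)))
      refine h.trans_eq ?_
      rw [traceForm_apply, one_mul, (hρ _ _).trace_eq_one, Complex.one_re]
    · have h := traceForm_mono_left (one_sub_kronecker_le ((hΛ c₁).le_one m₁)
        ((hΓ c₂).le_one m₂)) (hρ0 (c₁ (m₁, l.1)) (c₂ (m₂, l.2)))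
      rwa [map_add, LinearMap.add_apply, traceForm_kronecker_one,
        traceForm_one_kronecker] at h
    · exact add_nonneg (traceForm_nonneg (hΛ' _ _) (traceRight_nonneg (hρ0 _ _)))
        (traceForm_nonneg (hΓ' _ _) (traceLeft_nonneg (hρ0 _ _)))
  choose sel hsel using hchoice
  set η : ℝ := 4 * (K / N + 2 * τ) + 2 * (η₁ + η₂) with hη
  have havg (m₁ : M₁) (m₂ : M₂) : ∑ c₁ : M₁ × L₁ → V₁, ∑ c₂ : M₂ × L₂ → V₂,
      prodWeight P₁ c₁ * (prodWeight P₂ c₂ * err c₁ c₂ m₁ m₂ (sel c₁ c₂ m₁ m₂)) ≤ η := by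
    have hpp (c₁ : M₁ × L₁ → V₁) (c₂ : M₂ × L₂ → V₂) (x y : ℝ) (h : x ≤ y) :
        prodWeight P₁ c₁ * (prodWeight P₂ c₂ * x) ≤ prodWeight P₁ c₁ * (prodWeight P₂ c₂ * y) :=
      mul_le_mul_of_nonneg_left (mul_le_mul_of_nonneg_left h (prodWeight_nonneg hP₂0 c₂))
        (prodWeight_nonneg hP₁0 c₁)
    refine (Finset.sum_le_sum fun c₁ _ => Finset.sum_le_sum fun c₂ _ =>
      hpp c₁ c₂ _ _ (hsel c₁ c₂ m₁ m₂)).trans ?_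
    have hcov := sum_sq_covering_le (L₁ := L₁) (L₂ := L₂) hP₁0 hP₂0 hP₁1 hP₂1 hw0 hwK hsum₁
      hsum₂ hwτ (a := fun l => (m₁, l)) (b := fun l => (m₂, l)) (Prod.mk_right_injective m₁)
      (Prod.mk_right_injective m₂)
    have h₁ (l : L₁ × L₂) : ∑ c₁ : M₁ × L₁ → V₁, ∑ c₂ : M₂ × L₂ → V₂, prodWeight P₁ c₁ *
        (prodWeight P₂ c₂ * (W c₁ c₂ m₁ m₂ l * s₁ c₁ c₂ m₁ m₂ l)) ≤ η₁ :=
      (sum_weighted_error_le (P := fun v₁ v₂ => P (v₁, v₂)) hP₁0 hP₂1 hw₁ (fun c => hΛ' c m₁)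
        (fun v₁ v₂ => traceRight_nonneg (hρ0 v₁ v₂)) (m₁, l.1) (m₂, l.2)).trans (hη₁ m₁ l.1)
    have h₂ (l : L₁ × L₂) : ∑ c₁ : M₁ × L₁ → V₁, ∑ c₂ : M₂ × L₂ → V₂, prodWeight P₁ c₁ *
        (prodWeight P₂ c₂ * (W c₁ c₂ m₁ m₂ l * s₂ c₁ c₂ m₁ m₂ l)) ≤ η₂ := by
      rw [Finset.sum_comm]
      refine le_trans (le_of_eq ?_) ((sum_weighted_error_le (P := fun v₂ v₁ => P (v₁, v₂))
        (w := fun v₂ v₁ => w v₁ v₂) hP₂0 hP₁1 (fun v₂ v₁ => hw₂ v₁ v₂) (fun c => hΓ' c m₂)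
        (fun v₂ v₁ => traceLeft_nonneg (hρ0 v₁ v₂)) (m₂, l.2) (m₁, l.1)).trans (hη₂ m₂ l.2))
      exact Finset.sum_congr rfl fun _ _ => Finset.sum_congr rfl fun _ _ => by
        rw [mul_left_comm]
    have hs := Finset.sum_le_card_nsmul (Finset.univ : Finset (L₁ × L₂)) _ (η₁ + η₂)
      fun l _ => add_le_add (h₁ l) (h₂ l)
    rw [nsmul_eq_mul, Finset.card_univ, ← hN] at hs
    have hsplit (c₁ : M₁ × L₁ → V₁) (c₂ : M₂ × L₂ → V₂) : prodWeight P₁ c₁ * (prodWeight P₂ c₂ *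
        (4 * ((∑ l, W c₁ c₂ m₁ m₂ l) / N - 1) ^ 2 +
          2 * ((∑ l, W c₁ c₂ m₁ m₂ l * (s₁ c₁ c₂ m₁ m₂ l + s₂ c₁ c₂ m₁ m₂ l)) / N))) =
        4 * (prodWeight P₁ c₁ * (prodWeight P₂ c₂ *
          ((∑ l, W c₁ c₂ m₁ m₂ l) / N - 1) ^ 2)) +
        2 / N * ∑ l, (prodWeight P₁ c₁ * (prodWeight P₂ c₂ *
            (W c₁ c₂ m₁ m₂ l * s₁ c₁ c₂ m₁ m₂ l)) + prodWeight P₁ c₁ * (prodWeight P₂ c₂ *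
            (W c₁ c₂ m₁ m₂ l * s₂ c₁ c₂ m₁ m₂ l))) := by
      simp only [← mul_add, ← Finset.mul_sum]
      ring
    have hswap (G : (M₁ × L₁ → V₁) → (M₂ × L₂ → V₂) → L₁ × L₂ → ℝ) :
        ∑ c₁, ∑ c₂, ∑ l, G c₁ c₂ l = ∑ l, ∑ c₁, ∑ c₂, G c₁ c₂ l := by
      rw [Finset.sum_congr rfl fun c₁ _ => Finset.sum_comm, Finset.sum_comm]
    have hlin (F : (M₁ × L₁ → V₁) → (M₂ × L₂ → V₂) → ℝ)
        (G H : (M₁ × L₁ → V₁) → (M₂ × L₂ → V₂) → L₁ × L₂ → ℝ) :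
        ∑ c₁, ∑ c₂, (4 * F c₁ c₂ + 2 / N * ∑ l, (G c₁ c₂ l + H c₁ c₂ l)) =
          4 * (∑ c₁, ∑ c₂, F c₁ c₂) +
            2 / N * ∑ l, (∑ c₁, ∑ c₂, G c₁ c₂ l + ∑ c₁, ∑ c₂, H c₁ c₂ l) := by
      simp only [Finset.sum_add_distrib, ← Finset.mul_sum, hswap]
    rw [Finset.sum_congr rfl fun c₁ _ => Finset.sum_congr rfl fun c₂ _ => hsplit c₁ c₂, hlin]
    have h3 := mul_le_mul_of_nonneg_left hs (div_nonneg zero_le_two hN0.le)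
    have h4 : 2 / N * (N * (η₁ + η₂)) = 2 * (η₁ + η₂) := by field_simp
    rw [hη]
    linarith
  -- Derandomization: one pair of codebooks is fixed for the error summed over all message pairs.
  obtain ⟨⟨c₁, c₂⟩, hc⟩ := exists_le_of_sum_mul_le
    (p := fun c : (M₁ × L₁ → V₁) × (M₂ × L₂ → V₂) => prodWeight P₁ c.1 * prodWeight P₂ c.2)
    (f := fun c => ∑ m₁, ∑ m₂, err c.1 c.2 m₁ m₂ (sel c.1 c.2 m₁ m₂))
    (x := Fintype.card M₁ * (Fintype.card M₂ * η))
    (fun c => mul_nonneg (prodWeight_nonneg hP₁0 _) (prodWeight_nonneg hP₂0 _))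
    (by simp only [Fintype.sum_prod_type, ← Finset.mul_sum, sum_prodWeight P₂ hP₂1, mul_one,
          sum_prodWeight P₁ hP₁1]) (by
      calc _ = ∑ m₁, ∑ m₂, ∑ c₁ : M₁ × L₁ → V₁, ∑ c₂ : M₂ × L₂ → V₂,
            prodWeight P₁ c₁ * (prodWeight P₂ c₂ * err c₁ c₂ m₁ m₂ (sel c₁ c₂ m₁ m₂)) := by
            simp only [Fintype.sum_prod_type, Finset.mul_sum, mul_assoc]
            rw [Finset.sum_congr rfl fun c₁ _ => Finset.sum_comm, Finset.sum_comm]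
            refine Finset.sum_congr rfl fun m₁ _ => ?_
            rw [Finset.sum_congr rfl fun c₁ _ => Finset.sum_comm, Finset.sum_comm]
        _ ≤ ∑ m₁ : M₁, ∑ m₂ : M₂, η :=
            Finset.sum_le_sum fun m₁ _ => Finset.sum_le_sum fun m₂ _ => havg m₁ m₂
        _ = _ := by simp)
  exact ⟨fun m₁ m₂ => c₁ (m₁, (sel c₁ c₂ m₁ m₂).1), fun m₁ m₂ => c₂ (m₂, (sel c₁ c₂ m₁ m₂).2),
    Λ c₁, Γ c₂, hΛ c₁, hΓ c₂, hc⟩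

end BroadcastRandomCoding

/-! ### Classical-quantum states and their random decoders. -/

section ClassicalQuantumStates

open scoped MatrixOrder

variable {U B : Type*} [DecidableEq U]

/-- The classical-quantum state `∑ u, |u⟩⟨u| ⊗ A u`. -/
def cqState (A : U → Matrix B B ℂ) : Matrix (U × B) (U × B) ℂ :=
  Matrix.of fun x y => if x.1 = y.1 then A x.1 x.2 y.2 else 0

lemma cqState_conjTranspose (A : U → Matrix B B ℂ) :
    (cqState A).conjTranspose = cqState fun u => (A u).conjTranspose := by
  ext ⟨u, b⟩ ⟨u', b'⟩
  by_cases h : u = u'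
  · subst h
    simp [cqState, Matrix.conjTranspose_apply]
  · simp [cqState, Matrix.conjTranspose_apply, h, Ne.symm h]

lemma cqState_diagonal [DecidableEq B] (a : U → B → ℂ) :
    cqState (fun u => Matrix.diagonal (a u)) = Matrix.diagonal fun x : U × B => a x.1 x.2 := by
  ext ⟨u, b⟩ ⟨u', b'⟩
  by_cases h : u = u' <;> by_cases h' : b = b' <;> simp [cqState, h, h', Matrix.diagonal_apply]

lemma traceLeft_cqState [Fintype U] (A : U → Matrix B B ℂ) : traceLeft (cqState A) = ∑ u, A u := by
  ext b b'
  simp [traceLeft, cqState, Matrix.sum_apply]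

variable [Fintype U] [Fintype B]

lemma cqState_mul (A A' : U → Matrix B B ℂ) :
    cqState A * cqState A' = cqState fun u => A u * A' u := by
  ext ⟨u, b⟩ ⟨u', b'⟩
  by_cases h : u = u' <;> simp [cqState, Matrix.mul_apply, Fintype.sum_prod_type, h]

lemma traceRight_cqState {A : U → Matrix B B ℂ} {q : U → ℝ} (hq : ∀ u, (A u).trace = q u) :
    traceRight (cqState A) = conjDiag 1 q := by
  ext u u'
  rw [conjDiag, one_mul, Matrix.conjTranspose_one, mul_one, Matrix.diagonal_apply, ← hq]
  by_cases h : u = u' <;> simp [traceRight, cqState, h, Matrix.trace]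

variable [DecidableEq B]

/-- The block unitary `cqState W` diagonalizes the state, so its spectrum is the union of the
spectra of the blocks. -/
lemma mutualInfo_cqState {A : U → Matrix B B ℂ} {q : U → ℝ} {W : U → Matrix B B ℂ}
    {α : U → B → ℝ} {W₀ : Matrix B B ℂ} {l : B → ℝ}
    (hW : ∀ u, (W u).conjTranspose * W u = 1) (hA : ∀ u, A u = conjDiag (W u) (α u))
    (hW₀ : W₀.conjTranspose * W₀ = 1) (hAl : ∑ u, A u = conjDiag W₀ l)
    (hq : ∀ u, (A u).trace = q u) :
    mutualInfo (cqState A) =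
      shannonEntropy q + shannonEntropy l - shannonEntropy (fun x : U × B => α x.1 x.2) := by
  have h : cqState A = conjDiag (cqState W) (fun x : U × B => α x.1 x.2) := by
    rw [conjDiag, cqState_conjTranspose, ← cqState_diagonal (fun u b => (α u b : ℂ)), cqState_mul,
      cqState_mul]
    exact congrArg cqState (funext hA)
  have hiso : (cqState W).conjTranspose * cqState W = 1 := by
    rw [cqState_conjTranspose, cqState_mul]
    simp only [hW]
    simpa using cqState_diagonal (fun (_ : U) (_ : B) => (1 : ℂ))
  rw [mutualInfo, traceRight_cqState hq, traceLeft_cqState, hAl, h,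
    vonNeumannEntropy_conjDiag hW₀, vonNeumannEntropy_conjDiag hiso,
    vonNeumannEntropy_conjDiag (by simp)]

/-- Random codes of rate below the mutual information of a classical-quantum state have vanishing
expected error; with a single message there is nothing to decode. -/
lemma eventually_exists_random_decoder {A : U → Matrix B B ℂ} {q : U → ℝ} (hA : ∀ u, 0 ≤ A u)
    (hAq : ∀ u, (A u).trace = q u) (hq1 : ∑ u, q u = 1) {γ η : ℝ} (hγ : 0 < γ) (hη : 0 < η) :
    ∀ᶠ n : ℕ in Filter.atTop, ∀ m l : ℕ, 0 < m → 0 < l →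
      (m = 1 ∨ (m * l : ℝ) ≤ 2 * (2 : ℝ) ^ (n * (mutualInfo (cqState A) - γ))) →
      ∃ Λ : (Fin m × Fin l → Fin n → U) → Fin m → Matrix (Fin n → B) (Fin n → B) ℂ,
        (∀ c, IsPOVM (Λ c)) ∧ ∀ i j, ∑ c, prodWeight (prodWeight q) c *
          traceForm (1 - Λ c i) ((prodWeight q (c (i, j)))⁻¹ •
            piTensor fun t => A (c (i, j) t)) ≤ η := by
  choose W α hW hα hWα using fun u => exists_eq_conjDiag (hA u)
  obtain ⟨W₀, l₀, hW₀, hl₀, hAl⟩ :=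
    exists_eq_conjDiag (A := ∑ u, A u) (Finset.sum_nonneg fun u _ => hA u)
  have hαq (u : U) : ∑ k, α u k = q u := by
    have h := hAq u
    rw [hWα, trace_conjDiag (hW u)] at h
    exact_mod_cast h
  have hq0 (u : U) : 0 ≤ q u := hαq u ▸ Finset.sum_nonneg fun k _ => hα u k
  -- The tests lose `2 * (γ / 4)` in the exponent and the codebook rate stays `γ` below `I`, so the
  -- false alarms total at most `2 * 2 ^ (-n γ / 2)`.
  obtain ⟨C, hC⟩ := exists_typical_tests hW hα hWα hW₀ hl₀ hAl hαq hq1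
    (δ := γ / 4) (by positivity)
  rw [← mutualInfo_cqState hW hWα hW₀ hAl hAq] at hC
  set I := mutualInfo (cqState A)
  have hlim : Filter.Tendsto (fun n : ℕ => 2 * (C / n) +
      4 * (2 * ((2 : ℝ) ^ (-(γ / 2))) ^ n + 1 / n)) Filter.atTop
      (nhds (2 * 0 + 4 * (2 * 0 + 0))) := by
    have h1 := tendsto_const_div_atTop_nhds_zero_nat C
    have h2 := tendsto_const_div_atTop_nhds_zero_nat (1 : ℝ)
    have h3 : Filter.Tendsto (fun n : ℕ => ((2 : ℝ) ^ (-(γ / 2))) ^ n) Filter.atTop (nhds 0) :=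
      tendsto_pow_atTop_nhds_zero_of_lt_one (by positivity)
        (Real.rpow_lt_one_of_one_lt_of_neg one_lt_two (by linarith))
    exact (h1.const_mul 2).add (((h3.const_mul 2).add h2).const_mul 4)
  have hsmall := hlim.eventually_lt_const (u := η) (by simpa using hη)
  filter_upwards [hsmall, Filter.eventually_gt_atTop 0] with n hn hn0 m l hm hl hml
  have : NeZero m := ⟨hm.ne'⟩
  have : NeZero l := ⟨hl.ne'⟩
  by_cases hm1 : m = 1
  · subst hm1
    refine ⟨fun _ _ => 1, fun _ => ⟨fun _ => Matrix.PosSemidef.one, by simp⟩, fun i j => ?_⟩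
    simpa using hη.le
  have hcard := hml.resolve_left hm1
  obtain ⟨T, hT, hmiss, hfalse⟩ := hC n hn0
  obtain ⟨Λ, hΛ, herr⟩ := exists_random_coding_measurement (M := Fin m) (L := Fin l)
    (q := prodWeight q) (prodWeight_nonneg hq0) (sum_prodWeight q hq1)
    (A := fun v => piTensor fun t => A (v t)) (fun v => piTensor_nonneg fun t => hA _)
    (fun v => by
      simp only [hWα, piTensor_conjDiag]
      rw [trace_conjDiag (piTensor_isometry fun t => hW _), prodWeight,
        ← Fintype.prod_sum (fun t k => α (v t) k)]
      simp only [hαq]) hT hmiss hfalse (ε := 1 / n) (by positivity)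
  refine ⟨Λ, hΛ, fun i j => (herr i j).trans (le_trans ?_ hn.le)⟩
  have h1 : (Fintype.card (Fin m × Fin l) : ℝ) * (2 : ℝ) ^ (-(n * (I - 2 * (γ / 4)))) ≤
      2 * ((2 : ℝ) ^ (-(γ / 2))) ^ n := by
    rw [Fintype.card_prod, Fintype.card_fin, Fintype.card_fin, Nat.cast_mul]
    refine (mul_le_mul_of_nonneg_right hcard (by positivity)).trans_eq ?_
    rw [mul_assoc, ← Real.rpow_add two_pos, ← Real.rpow_natCast, ← Real.rpow_mul two_pos.le]
    congr 2
    ring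
  linarith

end ClassicalQuantumStates

/-! ### Marginals of the channel outputs and of the code state. -/

section BroadcastOutputs

open scoped MatrixOrder

variable {X B₁ B₂ : Type*} [Fintype B₁] [Fintype B₂] (N : Channel X B₁ B₂) {n : ℕ}

lemma Channel.traceRight_output (x : Fin n → X) :
    traceRight (N.output x) = piTensor fun i => traceRight (N.state (x i)) := by
  ext b b'
  simp only [traceRight, Channel.output, piTensor, Matrix.of_apply]
  rw [← Fintype.prod_sum (fun i c => N.state (x i) (b i, c) (b' i, c))]

lemma Channel.traceLeft_output (x : Fin n → X) :
    traceLeft (N.output x) = piTensor fun i => traceLeft (N.state (x i)) := by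
  ext b b'
  simp only [traceLeft, Channel.output, piTensor, Matrix.of_apply]
  rw [← Fintype.prod_sum (fun i c => N.state (x i) (c, b i) (c, b' i))]

lemma trace_piTensor {ι B : Type*} [Fintype ι] [DecidableEq ι] [Fintype B]
    (A : ι → Matrix B B ℂ) : (piTensor A).trace = ∏ i, (A i).trace := by
  simp only [Matrix.trace, Matrix.diag_apply, piTensor, Matrix.of_apply]
  rw [← Fintype.prod_sum (fun i b => A i b b)]

lemma piTensor_smul {ι B : Type*} [Fintype ι] (r : ι → ℝ) (A : ι → Matrix B B ℂ) :
    piTensor (fun i => r i • A i) = (∏ i, r i) • piTensor A := by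
  ext b b'
  simp [piTensor, Finset.prod_mul_distrib]

lemma Channel.isDensityMatrix_output (x : Fin n → X) : IsDensityMatrix (N.output x) where
  posSemidef := by
    classical
    have h : 0 ≤ piTensor fun i => N.state (x i) :=
      piTensor_nonneg fun i => (N.isDensityMatrix (x i)).posSemidef.nonneg
    -- Grouping the tensor factors by receiver only reindexes the basis.
    exact (Matrix.nonneg_iff_posSemidef.mp h).submatrix
      fun b : (Fin n → B₁) × (Fin n → B₂) => fun i => (b.1 i, b.2 i)
  trace_eq_one := by
    rw [← trace_traceRight, N.traceRight_output, trace_piTensor]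
    simp only [trace_traceRight, (N.isDensityMatrix _).trace_eq_one, Finset.prod_const_one]

variable {U₁ U₂ : Type*}

/-- The marginal channel to the first receiver is memoryless, which lets the decoders for tensor
powers of the single-letter blocks apply. -/
lemma Channel.sum_smul_traceRight_output [Fintype U₂] (p : U₁ × U₂ → ℝ) (f : U₁ → U₂ → X)
    (v₁ : Fin n → U₁) :
    ∑ v₂ : Fin n → U₂, (∏ i, p (v₁ i, v₂ i)) • traceRight (N.output fun i => f (v₁ i) (v₂ i)) =
      piTensor fun i => ∑ u₂, p (v₁ i, u₂) • traceRight (N.state (f (v₁ i) u₂)) := by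
  rw [← sum_piTensor (fun i u₂ => p (v₁ i, u₂) • traceRight (N.state (f (v₁ i) u₂)))]
  simp only [piTensor_smul, N.traceRight_output]

lemma Channel.sum_smul_traceLeft_output [Fintype U₁] (p : U₁ × U₂ → ℝ) (f : U₁ → U₂ → X)
    (v₂ : Fin n → U₂) :
    ∑ v₁ : Fin n → U₁, (∏ i, p (v₁ i, v₂ i)) • traceLeft (N.output fun i => f (v₁ i) (v₂ i)) =
      piTensor fun i => ∑ u₁, p (u₁, v₂ i) • traceLeft (N.state (f u₁ (v₂ i))) := by
  rw [← sum_piTensor (fun i u₁ => p (u₁, v₂ i) • traceLeft (N.state (f u₁ (v₂ i))))]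
  simp only [piTensor_smul, N.traceLeft_output]

variable [Fintype U₁] [DecidableEq U₁] [Fintype U₂] [DecidableEq U₂]

lemma Channel.codeState_apply (p : U₁ × U₂ → ℝ) (f : U₁ → U₂ → X) (u₁ u₁' : U₁) (u₂ u₂' : U₂)
    (b b' : B₁ × B₂) :
    N.codeState p f (u₁, u₂, b) (u₁', u₂', b') =
      if u₁ = u₁' ∧ u₂ = u₂' then (p (u₁, u₂) : ℂ) * N.state (f u₁ u₂) b b' else 0 := by
  simp only [Channel.codeState, Matrix.sum_apply, Matrix.smul_apply, Matrix.kroneckerMap_apply,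
    Matrix.single_apply, smul_eq_mul]
  rw [Finset.sum_eq_single u₁ (fun a _ ha => by simp [ha]) (by simp),
    Finset.sum_eq_single u₂ (fun a _ ha => by simp [ha]) (by simp)]
  by_cases h₁ : u₁ = u₁' <;> by_cases h₂ : u₂ = u₂' <;> simp [h₁, h₂]

lemma Channel.reduceU₁B₁_codeState (p : U₁ × U₂ → ℝ) (f : U₁ → U₂ → X) :
    reduceU₁B₁ (N.codeState p f) =
      cqState fun u₁ => ∑ u₂, p (u₁, u₂) • traceRight (N.state (f u₁ u₂)) := by
  ext ⟨u, b⟩ ⟨u', b'⟩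
  simp only [reduceU₁B₁, Matrix.of_apply, N.codeState_apply, cqState]
  by_cases h : u = u' <;> simp [h, Matrix.sum_apply, traceRight, Finset.mul_sum]

lemma Channel.reduceU₂B₂_codeState (p : U₁ × U₂ → ℝ) (f : U₁ → U₂ → X) :
    reduceU₂B₂ (N.codeState p f) =
      cqState fun u₂ => ∑ u₁, p (u₁, u₂) • traceLeft (N.state (f u₁ u₂)) := by
  ext ⟨u, b⟩ ⟨u', b'⟩
  simp only [reduceU₂B₂, Matrix.of_apply, N.codeState_apply, cqState]
  by_cases h : u = u' <;> simp [h, Matrix.sum_apply, traceLeft, Finset.mul_sum]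

lemma Channel.mutualInfo_reduceU₁U₂_codeState (p : U₁ × U₂ → ℝ) (f : U₁ → U₂ → X) :
    mutualInfo (reduceU₁U₂ (N.codeState p f)) =
      shannonEntropy (fun u₁ => ∑ u₂, p (u₁, u₂)) + shannonEntropy (fun u₂ => ∑ u₁, p (u₁, u₂)) -
        shannonEntropy p := by
  have h : reduceU₁U₂ (N.codeState p f) =
      cqState fun u₁ => conjDiag 1 fun u₂ => p (u₁, u₂) := by
    ext ⟨u₁, u₂⟩ ⟨u₁', u₂'⟩
    have htr : ∑ b₁, ∑ b₂, N.state (f u₁ u₂) (b₁, b₂) (b₁, b₂) = 1 := by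
      rw [← (N.isDensityMatrix (f u₁ u₂)).trace_eq_one, Matrix.trace, Fintype.sum_prod_type]
      rfl
    simp only [reduceU₁U₂, Matrix.of_apply, N.codeState_apply, cqState, conjDiag, one_mul,
      Matrix.conjTranspose_one, mul_one, Matrix.diagonal_apply]
    by_cases h₁ : u₁ = u₁'
    · by_cases h₂ : u₂ = u₂'
      · subst h₁ h₂
        simp [← Finset.mul_sum, htr]
      · simp [h₂]
    · simp [h₁]
  rw [h, mutualInfo_cqState (q := fun u₁ => ∑ u₂, p (u₁, u₂)) (W := fun _ => 1) (W₀ := 1)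
    (l := fun u₂ => ∑ u₁, p (u₁, u₂)) (by simp) (fun _ => rfl) (by simp) ?_
    (fun u₁ => trace_conjDiag (by simp) _)]
  ext u₂ u₂'
  simp only [conjDiag, one_mul, Matrix.conjTranspose_one, mul_one, Matrix.sum_apply,
    Matrix.diagonal_apply]
  by_cases h₂ : u₂ = u₂' <;> simp [h₂]

end BroadcastOutputs

/-! ### Message counts and bin rates. -/

section Rates

lemma one_le_messageCount (n : ℕ) (R : ℝ) : 1 ≤ messageCount n R := le_max_left _ _

lemma messageCount_eq_one (n : ℕ) {R : ℝ} (hR : R ≤ 0) : messageCount n R = 1 := by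
  have h : (2 : ℝ) ^ ((n : ℝ) * R) ≤ 1 :=
    Real.rpow_le_one_of_one_le_of_nonpos one_le_two
      (mul_nonpos_of_nonneg_of_nonpos (Nat.cast_nonneg n) hR)
  have h' := Nat.floor_mono h
  rw [Nat.floor_one] at h'
  exact max_eq_left h'

lemma messageCount_le (n : ℕ) {R : ℝ} (hR : 0 ≤ R) :
    (messageCount n R : ℝ) ≤ (2 : ℝ) ^ ((n : ℝ) * R) := by
  rw [messageCount, Nat.cast_max, Nat.cast_one]
  exact max_le (Real.one_le_rpow one_le_two (by positivity)) (Nat.floor_le (by positivity))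

/-- A codebook size `⌈2 ^ (n r)⌉` per message for which the total rate of the codebook is below
`I`, unless there is a single message. -/
lemma exists_binning_rate {R I s δ : ℝ} (hRI : R ≤ I) (hs : 0 ≤ s) (hδ : 0 < δ) :
    ∃ r : ℝ, 0 ≤ r ∧ (s ≤ r ∨ r = I - R + δ / 2) ∧ ∀ n : ℕ, messageCount n (R - δ) = 1 ∨
      (messageCount n (R - δ) * ⌈(2 : ℝ) ^ (n * r)⌉₊ : ℝ) ≤
        2 * (2 : ℝ) ^ (n * (I - δ / 2)) := by
  rcases le_or_gt (R - δ) 0 with h | h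
  · exact ⟨s, hs, Or.inl le_rfl, fun n => Or.inl (messageCount_eq_one n h)⟩
  · have hr : 0 ≤ I - R + δ / 2 := by linarith
    -- Chosen so that `(R - δ) + r = I - δ / 2`; the factor 2 absorbs the ceiling.
    refine ⟨I - R + δ / 2, hr, Or.inr rfl, fun n => Or.inr ?_⟩
    have h1 := messageCount_le n h.le
    have h2 : (1 : ℝ) ≤ (2 : ℝ) ^ (n * (I - R + δ / 2)) :=
      Real.one_le_rpow one_le_two (by positivity)
    have h3 := Nat.ceil_lt_add_one (zero_le_one.trans h2)
    calc (messageCount n (R - δ) * ⌈(2 : ℝ) ^ (n * (I - R + δ / 2))⌉₊ : ℝ)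
        ≤ (2 : ℝ) ^ (n * (R - δ)) * (2 * (2 : ℝ) ^ (n * (I - R + δ / 2))) :=
          mul_le_mul h1 (by linarith) (by positivity) (by positivity)
      _ = 2 * ((2 : ℝ) ^ (n * (R - δ)) * (2 : ℝ) ^ (n * (I - R + δ / 2))) := by ring
      _ = 2 * (2 : ℝ) ^ (n * (I - δ / 2)) := by
          rw [← Real.rpow_add two_pos]
          congr 2
          ring

end Rates

/-- Large deviations of the log-likelihood ratio of a joint distribution and the product of its
marginals. -/
lemma eventually_sum_atypical_pairs_le {U₁ U₂ : Type*} [Fintype U₁] [Fintype U₂]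
    {p : U₁ × U₂ → ℝ} (hp0 : ∀ u, 0 ≤ p u) (hp : ∑ u, p u = 1) {I : ℝ}
    (hI : I = shannonEntropy (fun u₁ => ∑ u₂, p (u₁, u₂)) +
      shannonEntropy (fun u₂ => ∑ u₁, p (u₁, u₂)) - shannonEntropy p) {δ τ : ℝ} (hδ : 0 < δ)
    (hτ : 0 < τ) :
    ∀ᶠ n : ℕ in Filter.atTop, ∑ v : (Fin n → U₁) × (Fin n → U₂),
      (if prodWeight (fun u₁ => ∑ u₂, p (u₁, u₂)) v.1 *
        prodWeight (fun u₂ => ∑ u₁, p (u₁, u₂)) v.2 * (2 : ℝ) ^ (n * (I + δ)) <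
          ∏ i, p (v.1 i, v.2 i) then ∏ i, p (v.1 i, v.2 i) else 0) ≤ τ := by
  set p₁ : U₁ → ℝ := fun u₁ => ∑ u₂, p (u₁, u₂) with hp₁
  set p₂ : U₂ → ℝ := fun u₂ => ∑ u₁, p (u₁, u₂) with hp₂
  have hle₁ (u : U₁ × U₂) : p u ≤ p₁ u.1 :=
    Finset.single_le_sum (f := fun u₂ => p (u.1, u₂)) (fun _ _ => hp0 _) (Finset.mem_univ u.2)
  have hle₂ (u : U₁ × U₂) : p u ≤ p₂ u.2 :=
    Finset.single_le_sum (f := fun u₁ => p (u₁, u.2)) (fun _ _ => hp0 _) (Finset.mem_univ u.1)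
  obtain ⟨C, hC⟩ := sum_prodWeight_atypical_le hp0 hp (fun u => p₁ u.1 * p₂ u.2) p
    (fun u h => mul_pos (h.trans_le (hle₁ u)) (h.trans_le (hle₂ u))) (fun _ h => h) (μ := I) (by
      have hterm (u : U₁ × U₂) : p u * (Real.logb 2 (p u) - Real.logb 2 (p₁ u.1 * p₂ u.2)) =
          p u * Real.logb 2 (p u) - p u * Real.logb 2 (p₁ u.1) - p u * Real.logb 2 (p₂ u.2) := by
        by_cases h : p u = 0
        · simp [h]
        · have h0 := lt_of_le_of_ne (hp0 u) (Ne.symm h)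
          rw [Real.logb_mul (h0.trans_le (hle₁ u)).ne' (h0.trans_le (hle₂ u)).ne']
          ring
      have e₁ : ∑ u : U₁ × U₂, p u * Real.logb 2 (p₁ u.1) =
          ∑ u₁, p₁ u₁ * Real.logb 2 (p₁ u₁) := by
        rw [Fintype.sum_prod_type]
        simp only [← Finset.sum_mul, hp₁]
      have e₂ : ∑ u : U₁ × U₂, p u * Real.logb 2 (p₂ u.2) =
          ∑ u₂, p₂ u₂ * Real.logb 2 (p₂ u₂) := by
        rw [Fintype.sum_prod_type_right]
        simp only [← Finset.sum_mul, hp₂]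
      simp only [hterm, Finset.sum_sub_distrib]
      rw [e₁, e₂, hI, shannonEntropy, shannonEntropy, shannonEntropy]
      ring) hδ
  have hlim := (tendsto_const_div_atTop_nhds_zero_nat C).eventually_lt_const hτ
  filter_upwards [hlim, Filter.eventually_gt_atTop 0] with n hn hn0
  refine le_trans (le_of_eq ?_) ((hC n hn0).trans hn.le)
  rw [← (Equiv.arrowProdEquivProdArrow (Fin n) (fun _ => U₁) (fun _ => U₂)).symm.sum_comp]
  refine Finset.sum_congr rfl fun v _ => ?_
  rw [Finset.prod_mul_distrib]
  rfl

/-! ### Choice of parameters and the inner bound. -/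

section Marton

open scoped MatrixOrder

variable {X B₁ B₂ : Type*} [Fintype B₁] [DecidableEq B₁] [Fintype B₂] [DecidableEq B₂]

/-- A broadcast code without a common message is a code with a common message of rate `R ≤ 0`. -/
lemma nonempty_code_of_broadcast_code (N : Channel X B₁ B₂) {n : ℕ} {R₁ R R₂ ε : ℝ} (hR : R ≤ 0)
    (x : Fin (messageCount n R₁) → Fin (messageCount n R₂) → Fin n → X)
    {Λ : Fin (messageCount n R₁) → Matrix (Fin n → B₁) (Fin n → B₁) ℂ}
    {Γ : Fin (messageCount n R₂) → Matrix (Fin n → B₂) (Fin n → B₂) ℂ} (hΛ : IsPOVM Λ)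
    (hΓ : IsPOVM Γ)
    (herr : ∑ m₁, ∑ m₂, (((1 - Λ m₁ ⊗ₖ Γ m₂) * N.output (x m₁ m₂)).trace).re ≤
      messageCount n R₁ * (messageCount n R₂ * ε)) :
    Nonempty (Code N n R₁ R R₂ ε) := by
  have h1 := messageCount_eq_one n hR
  have hc₁ : (0 : ℝ) < messageCount n R₁ := by exact_mod_cast one_le_messageCount n R₁
  have hc₂ : (0 : ℝ) < messageCount n R₂ := by exact_mod_cast one_le_messageCount n R₂
  refine ⟨⟨fun m₁ _ m₂ => x m₁ m₂, fun m => Λ m.1, fun m => Γ m.2,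
    ⟨fun m => hΛ.posSemidef m.1, ?_⟩, ⟨fun m => hΓ.posSemidef m.2, ?_⟩, ?_⟩⟩
  · simp [Fintype.sum_prod_type, h1, hΛ.sum_eq_one]
  · simp [Fintype.sum_prod_type_right, h1, hΓ.sum_eq_one]
  · simp only [Finset.sum_const, Finset.card_univ, Fintype.card_fin, h1, one_smul, Nat.cast_one,
      mul_one]
    rw [one_div, inv_mul_le_iff₀ (mul_pos hc₁ hc₂), mul_assoc]
    exact herr

variable {U₁ U₂ : Type*} [Fintype U₁] [DecidableEq U₁] [Fintype U₂] [DecidableEq U₂]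

/-- Marton's inner bound for a classical-quantum broadcast channel, without common message. -/
lemma Channel.achievable_marton (N : Channel X B₁ B₂) {p : U₁ × U₂ → ℝ}
    (hp : p ∈ stdSimplex ℝ (U₁ × U₂)) (f : U₁ → U₂ → X) {R₁ R₂ : ℝ}
    (h₁ : R₁ ≤ mutualInfo (reduceU₁B₁ (N.codeState p f)))
    (h₂ : R₂ ≤ mutualInfo (reduceU₂B₂ (N.codeState p f)))
    (h₁₂ : R₁ + R₂ ≤ mutualInfo (reduceU₁B₁ (N.codeState p f)) +
      mutualInfo (reduceU₂B₂ (N.codeState p f)) - mutualInfo (reduceU₁U₂ (N.codeState p f))) :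
    N.Achievable R₁ 0 R₂ := by
  obtain ⟨hp0, hp1⟩ := hp
  have hIU := N.mutualInfo_reduceU₁U₂_codeState p f
  rw [N.reduceU₁B₁_codeState] at h₁ h₁₂
  rw [N.reduceU₂B₂_codeState] at h₂ h₁₂
  set A₁ : U₁ → Matrix B₁ B₁ ℂ := fun u₁ => ∑ u₂, p (u₁, u₂) • traceRight (N.state (f u₁ u₂))
    with hA₁
  set A₂ : U₂ → Matrix B₂ B₂ ℂ := fun u₂ => ∑ u₁, p (u₁, u₂) • traceLeft (N.state (f u₁ u₂))
    with hA₂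
  set I₁ := mutualInfo (cqState A₁)
  set I₂ := mutualInfo (cqState A₂)
  set I₁₂ := mutualInfo (reduceU₁U₂ (N.codeState p f))
  set p₁ : U₁ → ℝ := fun u₁ => ∑ u₂, p (u₁, u₂) with hp₁
  set p₂ : U₂ → ℝ := fun u₂ => ∑ u₁, p (u₁, u₂) with hp₂
  have hA₁0 (u : U₁) : 0 ≤ A₁ u := Finset.sum_nonneg fun u₂ _ =>
    smul_nonneg (hp0 _) (traceRight_nonneg (N.isDensityMatrix _).posSemidef.nonneg)
  have hA₂0 (u : U₂) : 0 ≤ A₂ u := Finset.sum_nonneg fun u₁ _ =>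
    smul_nonneg (hp0 _) (traceLeft_nonneg (N.isDensityMatrix _).posSemidef.nonneg)
  have hA₁p (u : U₁) : (A₁ u).trace = p₁ u := by
    simp only [hA₁, hp₁, Matrix.trace_sum, Matrix.trace_smul, trace_traceRight,
      (N.isDensityMatrix _).trace_eq_one]
    simp
  have hA₂p (u : U₂) : (A₂ u).trace = p₂ u := by
    simp only [hA₂, hp₂, Matrix.trace_sum, Matrix.trace_smul, trace_traceLeft,
      (N.isDensityMatrix _).trace_eq_one]
    simp
  have hp₁1 : ∑ u, p₁ u = 1 := by rw [← hp1, Fintype.sum_prod_type]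
  have hp₂1 : ∑ u, p₂ u = 1 := by rw [← hp1, Fintype.sum_prod_type_right]
  intro ε hε δ hδ
  have hs : 0 ≤ |I₁₂| + δ := add_nonneg (abs_nonneg _) hδ.le
  obtain ⟨r₁, hr₁0, hr₁, hcard₁⟩ := exists_binning_rate h₁ hs hδ
  obtain ⟨r₂, hr₂0, hr₂, hcard₂⟩ := exists_binning_rate h₂ hs hδ
  -- A bin rate of at least `|I₁₂| + δ` suffices alone, the other being nonnegative. Otherwise both
  -- rates are `Iᵢ - Rᵢ + δ / 2` and the sum-rate hypothesis applies.
  have hr : I₁₂ + δ ≤ r₁ + r₂ := by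
    have := le_abs_self I₁₂
    rcases hr₁ with hr₁ | hr₁ <;> rcases hr₂ with hr₂ | hr₂ <;> linarith
  have hlim : Filter.Tendsto (fun n : ℕ => ((2 : ℝ) ^ (-(δ / 2))) ^ n) Filter.atTop (nhds 0) :=
    tendsto_pow_atTop_nhds_zero_of_lt_one (by positivity)
      (Real.rpow_lt_one_of_one_lt_of_neg one_lt_two (by linarith))
  have hγ : 0 < δ / 2 := by positivity
  -- The error budget is `4 * (ε/16 + 2 * (ε/32)) + 2 * (ε/16 + ε/16) = 3ε/4`.
  obtain ⟨n₀, hn₀⟩ := Filter.eventually_atTop.mp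
    ((eventually_exists_random_decoder hA₁0 hA₁p hp₁1 hγ (η := ε / 16) (by positivity)).and
    ((eventually_exists_random_decoder hA₂0 hA₂p hp₂1 hγ (η := ε / 16) (by positivity)).and
    ((eventually_sum_atypical_pairs_le hp0 hp1 hIU hγ (τ := ε / 32) (by positivity)).and
    (hlim.eventually_lt_const (u := ε / 16) (by positivity)))))
  refine ⟨n₀, fun n hn => ?_⟩
  obtain ⟨hdec₁, hdec₂, hτ, hsmall⟩ := hn₀ n hn
  set l₁ := ⌈(2 : ℝ) ^ (n * r₁)⌉₊
  set l₂ := ⌈(2 : ℝ) ^ (n * r₂)⌉₊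
  have hl₁0 : 0 < l₁ := Nat.ceil_pos.mpr (by positivity)
  have hl₂0 : 0 < l₂ := Nat.ceil_pos.mpr (by positivity)
  obtain ⟨Λ, hΛ, hΛerr⟩ := hdec₁ _ l₁ (one_le_messageCount n (R₁ - δ)) hl₁0 (hcard₁ n)
  obtain ⟨Γ, hΓ, hΓerr⟩ := hdec₂ _ l₂ (one_le_messageCount n (R₂ - δ)) hl₂0 (hcard₂ n)
  have : NeZero l₁ := ⟨hl₁0.ne'⟩
  have : NeZero l₂ := ⟨hl₂0.ne'⟩
  obtain ⟨x₁, x₂, Λ', Γ', hΛ', hΓ', herr⟩ := exists_broadcast_code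
    (P := fun v : (Fin n → U₁) × (Fin n → U₂) => ∏ i, p (v.1 i, v.2 i))
    (P₁ := prodWeight p₁) (P₂ := prodWeight p₂)
    (fun v => Finset.prod_nonneg fun i _ => hp0 _)
    (by
      rw [← sum_prodWeight (ι := Fin n) p hp1, ← (Equiv.arrowProdEquivProdArrow (Fin n)
        (fun _ => U₁) (fun _ => U₂)).symm.sum_comp]
      rfl)
    (fun v₁ => (Fintype.prod_sum fun i u₂ => p (v₁ i, u₂)).symm)
    (fun v₂ => (Fintype.prod_sum fun i u₁ => p (u₁, v₂ i)).symm)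
    (K := (2 : ℝ) ^ (n * (I₁₂ + δ / 2))) (by positivity) hτ
    (ρ := fun v₁ v₂ => N.output fun i => f (v₁ i) (v₂ i))
    (fun v₁ v₂ => N.isDensityMatrix_output _) hΛ hΓ
    (fun m l => by simpa only [N.sum_smul_traceRight_output] using hΛerr m l)
    (fun m l => by simpa only [N.sum_smul_traceLeft_output] using hΓerr m l)
  refine nonempty_code_of_broadcast_code N (by linarith)
    (fun m₁ m₂ i => f (x₁ m₁ m₂ i) (x₂ m₁ m₂ i)) hΛ' hΓ' (herr.trans ?_)
  simp only [Fintype.card_fin, Fintype.card_prod, Nat.cast_mul]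
  refine mul_le_mul_of_nonneg_left (mul_le_mul_of_nonneg_left ?_ (Nat.cast_nonneg _))
    (Nat.cast_nonneg _)
  -- The number of bin pairs exceeds the truncation level by the margin between `I₁₂ + δ` and `I₁₂ +
  -- δ / 2`.
  have hK : (2 : ℝ) ^ (n * (I₁₂ + δ / 2)) / (l₁ * l₂) ≤ ((2 : ℝ) ^ (-(δ / 2))) ^ n := by
    rw [div_le_iff₀ (by positivity)]
    have hl : (2 : ℝ) ^ (n * (r₁ + r₂)) ≤ l₁ * l₂ := by
      rw [mul_add, Real.rpow_add two_pos]
      exact mul_le_mul (Nat.le_ceil _) (Nat.le_ceil _) (by positivity) (by positivity)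
    refine le_trans ?_ (mul_le_mul_of_nonneg_left hl (by positivity))
    rw [← Real.rpow_natCast, ← Real.rpow_mul two_pos.le, ← Real.rpow_add two_pos]
    refine Real.rpow_le_rpow_of_exponent_le one_le_two ?_
    have := mul_le_mul_of_nonneg_left hr (Nat.cast_nonneg (α := ℝ) n)
    linarith
  linarith

end Marton

end CQBroadcast

end

theorem mainTheorem7 {X U₁ U₂ B₁ B₂ : Type*}
    [Fintype U₁] [DecidableEq U₁] [Fintype U₂] [DecidableEq U₂]
    [Fintype B₁] [DecidableEq B₁] [Fintype B₂] [DecidableEq B₂]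
    (N : CQBroadcast.Channel X B₁ B₂) (p : U₁ × U₂ → ℝ) (hp : p ∈ stdSimplex ℝ (U₁ × U₂))
    (f : U₁ → U₂ → X) (R₁ R₂ : ℝ) (hR₁ : 0 ≤ R₁) (hR₂ : 0 ≤ R₂)
    (h₁ : R₁ ≤ CQBroadcast.mutualInfo (CQBroadcast.reduceU₁B₁ (N.codeState p f)))
    (h₂ : R₂ ≤ CQBroadcast.mutualInfo (CQBroadcast.reduceU₂B₂ (N.codeState p f)))
    (h₁₂ : R₁ + R₂ ≤ CQBroadcast.mutualInfo (CQBroadcast.reduceU₁B₁ (N.codeState p f)) +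
      CQBroadcast.mutualInfo (CQBroadcast.reduceU₂B₂ (N.codeState p f)) -
      CQBroadcast.mutualInfo (CQBroadcast.reduceU₁U₂ (N.codeState p f))) :
    N.Achievable R₁ 0 R₂ := by
  exact N.achievable_marton hp f h₁ h₂ h₁₂
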